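/- Let $m$ be an odd positive integer and let $\mathbb{R}_m$ be the real Clifford algebra generated by $e_1,\dots,e_m$ with $e_ie_j+e_je_i=-2\delta_{ij}$, with Clifford conjugation $x\mapsto x^c$ (the anti-involution with $e_j^c=-e_j$) and imaginary units $\mathbb{S}=\{J\in\mathbb{R}_m: J+J^c=0,\ JJ^c=1\}$. Identify $\mathbb{R}^{m+1}$ with the space of paravectors $x_0+x_1e_1+\dots+x_me_m$ in $\mathbb{R}_m$. Let $D\subset\mathbb{C}$ be open and invariant under complex conjugation, and assume that either $D$ is connected and $D\cap\mathbb{R}\neq\emptyset$, or $D\cap\mathbb{R}=\emptyset$ and $D=D^+\cup\overline{D^+}$ with $D^+$ connected and nonempty (where $\overline{D^+}$ is the complex conjugate of $D^+$). Put $\Omega_D=\{\alpha+J\beta:\alpha+i\beta\in D,\ J\in\mathbb{S}\}$ and $\Omega=\Omega_D\cap\mathbb{R}^{m+1}$. Let $\mathcal{SR}(\Omega_D)$ be the set of slice regular functions on $\Omega_D$, that is, of the functions $f:\Omega_D\to\mathbb{R}_m$ of the form $f(\alpha+J\beta)=F_0(\alpha+i\beta)+JF_1(\alpha+i\beta)$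 for a holomorphic $F=F_0+iF_1:D\to\mathbb{R}_m\otimes\mathbb{C}$ with $F(\bar z)=\overline{F(z)}$, where $\overline{a+ib}=a-ib$ for $a,b\in\mathbb{R}_m$. Let $\Delta$ be the Laplacian of $\mathbb{R}^{m+1}$ and $\overline\partial=\frac12\bigl(\partial_{x_0}+\sum_{j=1}^m e_j\partial_{x_j}\bigr)$. A function on $\Omega$ with values in $\mathbb{R}_m$ is holomorphic Cliffordian of order $k$ if it is of class $\mathcal{C}^{2k+1}$ and is annihilated by $\overline\partial\Delta^k$ on $\Omega$. **Theorem.** Let $k\ge 0$ be an integer with $k<\frac{m-1}{2}$ and let $f\in\mathcal{SR}(\Omega_D)$. Then $f|_\Omega$ is holomorphic Cliffordian of order $k$ if and only if $f$ is a slice regular polynomial of degree at most $2k$, i.e. there are $a_0,\dots,a_{2k}\in\mathbb{R}_m$ with $f(x)=\sum_{n=0}^{2k}x^na_n$ for all $x\in\Omega_D$. In other words, for the operator $\mathfrak{F}_k:f\mapsto\overline\partial\Delta^k(f|_\Omega)$ on $\mathcal{SR}(\Omega_D)$, $\ker\mathfrak{F}_k$ is the set $A_{2k}[x]$ of (restrictions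 to $\Omega_D$ of) polynomials $\sum_{n=0}^{2k}x^na_n$ with coefficients $a_n\in A=\mathbb{R}_m$. -/

import Mathlib

open scoped ComplexConjugate

noncomputable section

namespace SliceClifford

/-- The negative definite form `v ↦ -(v₁² + ⋯ + vₘ²)` on `ℝᵐ`. -/
def negSq (m : ℕ) : QuadraticForm ℝ (Fin m → ℝ) :=
  QuadraticMap.weightedSumSquares ℝ (fun _ : Fin m => (-1 : ℝ))

/-- The real Clifford algebra `ℝ_m` with `m` anticommuting imaginary units `e_j`, `e_j² = -1`.
Mathlib's `star` on it is the Clifford conjugation `x ↦ xᶜ`, the anti-involution with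
`e_jᶜ = -e_j`. -/
abbrev RC (m : ℕ) : Type := CliffordAlgebra (negSq m)

/-- The imaginary unit `e_j`. -/
def e {m : ℕ} (j : Fin m) : RC m := CliffordAlgebra.ι (negSq m) (Pi.single j 1)

/-- The real basis of `ℝ_m` indexed by subsets of `{1, …, m}`, transported from the standard
basis of the exterior algebra. -/
def basisRC (m : ℕ) : Module.Basis (Finset (Fin m)) ℝ (RC m) :=
  ((Pi.basisFun ℝ (Fin m)).ExteriorAlgebra).map (CliffordAlgebra.equivExterior (negSq m)).symm

/-- Coordinates on `ℝ_m`. -/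
def coordRC (m : ℕ) : RC m ≃ₗ[ℝ] EuclideanSpace ℝ (Finset (Fin m)) :=
  (basisRC m).equivFun.trans (WithLp.linearEquiv 2 ℝ (Finset (Fin m) → ℝ)).symm

/-- The Euclidean norm of the `2^m` real coordinates; `ℝ_m` is finite dimensional, so every norm
gives the same derivatives and smoothness classes. -/
instance instNormedAddCommGroupRC (m : ℕ) : NormedAddCommGroup (RC m) :=
  NormedAddCommGroup.induced (RC m) (EuclideanSpace ℝ (Finset (Fin m))) (coordRC m)
    (coordRC m).injective

instance instNormedSpaceRC (m : ℕ) : NormedSpace ℝ (RC m) :=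
  NormedSpace.induced ℝ (RC m) (EuclideanSpace ℝ (Finset (Fin m))) (coordRC m)

/-- The set of imaginary units: `t(J) = J + Jᶜ = 0` and `n(J) = J Jᶜ = 1`. -/
def imUnits (m : ℕ) : Set (RC m) := {J | J + star J = 0 ∧ J * star J = 1}

/-- The circular set `Ω_D = {α + Jβ : α + iβ ∈ D, J an imaginary unit}`. -/
def circ (m : ℕ) (D : Set ℂ) : Set (RC m) :=
  {x | ∃ z ∈ D, ∃ J ∈ imUnits m, x = algebraMap ℝ (RC m) z.re + z.im • J}

theorem mem_circ {m : ℕ} {D : Set ℂ} {z : ℂ} (hz : z ∈ D) {J : RC m} (hJ : J ∈ imUnits m) :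
    algebraMap ℝ (RC m) z.re + z.im • J ∈ circ m D :=
  ⟨z, hz, J, hJ, rfl⟩

/-- `D` is connected and meets the real axis (`Ω_D` is a slice domain). -/
def IsSliceDomain (D : Set ℂ) : Prop :=
  IsConnected D ∧ ∃ r : ℝ, (r : ℂ) ∈ D

/-- `D` misses the real axis and is the union of a connected set `D⁺` and its complex conjugate
(`Ω_D` is a product domain). -/
def IsProductDomain (D : Set ℂ) : Prop :=
  (∀ r : ℝ, (r : ℂ) ∉ D) ∧
    ∃ Dplus : Set ℂ, IsConnected Dplus ∧ D = Dplus ∪ (fun z : ℂ => conj z) '' Dplus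

/-- `F = F₀ + i F₁ : D → ℝ_m ⊗ ℂ` is a stem function: `F(z̄)` is the conjugate of `F(z)`. -/
structure IsStem {m : ℕ} (D : Set ℂ) (F₀ F₁ : ℂ → RC m) : Prop where
  even : ∀ z ∈ D, F₀ (conj z) = F₀ z
  odd : ∀ z ∈ D, F₁ (conj z) = -F₁ z

/-- `F = F₀ + i F₁ : D → ℝ_m ⊗ ℂ` is holomorphic on the open set `D` for the complex structure
`i (a + i b) = -b + i a`: it is real differentiable and its differential satisfies
`dF(i v) = i dF(v)`. -/
structure IsHolo {m : ℕ} (D : Set ℂ) (F₀ F₁ : ℂ → RC m) : Prop where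
  diff₀ : ∀ z ∈ D, DifferentiableAt ℝ F₀ z
  diff₁ : ∀ z ∈ D, DifferentiableAt ℝ F₁ z
  cr₀ : ∀ z ∈ D, ∀ v : ℂ, fderiv ℝ F₀ z (Complex.I * v) = -fderiv ℝ F₁ z v
  cr₁ : ∀ z ∈ D, ∀ v : ℂ, fderiv ℝ F₁ z (Complex.I * v) = fderiv ℝ F₀ z v

/-- `f = 𝓘(F₀ + i F₁)`, that is, `f(α + Jβ) = F₀(α + iβ) + J F₁(α + iβ)` on `Ω_D`. -/
def IsInduced {m : ℕ} {D : Set ℂ} (F₀ F₁ : ℂ → RC m) (f : circ m D → RC m) : Prop :=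
  ∀ (z : ℂ) (hz : z ∈ D) (J : RC m) (hJ : J ∈ imUnits m),
    f ⟨algebraMap ℝ (RC m) z.re + z.im • J, mem_circ hz hJ⟩ = F₀ z + J * F₁ z

/-- The set `SR(Ω_D)` of slice regular functions `Ω_D → ℝ_m`. -/
def SR (m : ℕ) (D : Set ℂ) : Set (circ m D → RC m) :=
  {f | ∃ F₀ F₁ : ℂ → RC m, IsStem D F₀ F₁ ∧ IsHolo D F₀ F₁ ∧ IsInduced F₀ F₁ f}

/-- The paravector `x₀ + x₁ e₁ + ⋯ + xₘ eₘ` of `(x₀, …, xₘ) ∈ ℝ^{m+1}`. -/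
def paravector {m : ℕ} (x : EuclideanSpace ℝ (Fin (m + 1))) : RC m :=
  algebraMap ℝ (RC m) (x 0) + ∑ j : Fin m, x j.succ • e j

/-- `Ω = Ω_D ∩ ℝ^{m+1}`. -/
def paraDomain (m : ℕ) (D : Set ℂ) : Set (EuclideanSpace ℝ (Fin (m + 1))) :=
  {x | paravector x ∈ circ m D}

open Classical in
/-- The restriction `f|_Ω`, extended by zero outside `Ω` (for open `D` the set `Ω` is open, so the
extension does not affect derivatives at points of `Ω`). -/
def restr {m : ℕ} {D : Set ℂ} (f : circ m D → RC m) : EuclideanSpace ℝ (Fin (m + 1)) → RC m :=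
  fun x => if h : paravector x ∈ circ m D then f ⟨paravector x, h⟩ else 0

/-- The Dirac operator `∂̄ = ½ (∂_{x₀} + ∑_j e_j ∂_{x_j})`. -/
def dirac {m : ℕ} (g : EuclideanSpace ℝ (Fin (m + 1)) → RC m) :
    EuclideanSpace ℝ (Fin (m + 1)) → RC m :=
  fun x => (1 / 2 : ℝ) • (fderiv ℝ g x (EuclideanSpace.single 0 1) +
    ∑ j : Fin m, e j * fderiv ℝ g x (EuclideanSpace.single j.succ 1))

/-- `∂̄ Δ^k g`, with `Δ` the Laplacian of `ℝ^{m+1}`. -/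
def diracLap {m : ℕ} (k : ℕ) (g : EuclideanSpace ℝ (Fin (m + 1)) → RC m) :
    EuclideanSpace ℝ (Fin (m + 1)) → RC m :=
  dirac ((fun h : EuclideanSpace ℝ (Fin (m + 1)) → RC m => Laplacian.laplacian h)^[k] g)

/-- `g` is holomorphic Cliffordian of order `k` on the open set `U`: it is of class `C^{2k+1}` and
`∂̄ Δ^k g = 0` there. -/
def IsHolCliffordian {m : ℕ} (k : ℕ) (U : Set (EuclideanSpace ℝ (Fin (m + 1))))
    (g : EuclideanSpace ℝ (Fin (m + 1)) → RC m) : Prop :=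
  ContDiffOn ℝ ((2 * k + 1 : ℕ) : WithTop ℕ∞) g U ∧ ∀ x ∈ U, diracLap k g x = 0

/-- The operator `𝔉_k : f ↦ ∂̄ Δ^k (f|_Ω)` on `SR(Ω_D)`, with values in functions on `Ω`. -/
def opF {m : ℕ} {D : Set ℂ} (k : ℕ) (f : SR m D) : paraDomain m D → RC m :=
  fun x => diracLap k (restr f.1) x

/-- `ker 𝔉_k`, as a set of functions on `Ω_D`. -/
def kerF (m : ℕ) (D : Set ℂ) (k : ℕ) : Set (circ m D → RC m) :=
  {f | ∃ hf : f ∈ SR m D, opF k ⟨f, hf⟩ = 0}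

/-- The value `∑ xⁿ aₙ` at `x` of the polynomial with coefficients `aₙ`, written on the right. -/
def evalRight {m : ℕ} (P : Polynomial (RC m)) (x : RC m) : RC m :=
  P.sum fun n a => x ^ n * a

/-- `A_d[x]`: the slice regular polynomials of degree at most `d`, as functions on `Ω_D`. -/
def slicePoly (m : ℕ) (D : Set ℂ) (d : ℕ) : Set (circ m D → RC m) :=
  {f | ∃ P : Polynomial (RC m), P.natDegree ≤ d ∧ ∀ x : circ m D, f x = evalRight P x}

end SliceClifford

end

open scoped ContDiff ComplexConjugate

noncomputable section

/-! Write a paravector as `α + y` with `y` its vector part and `s = |y|²`. A slice regular function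
then becomes `H(α, s) + y G(α, s)` with `H = F₀` and `G = F₁/√s`, and holomorphy of `F₀ + i F₁`
turns into the system `∂_α H = G + 2s ∂_s G`, `∂_s H = -½ ∂_α G` (`IsCRPair`).

In these variables the operators are transparent. The Laplacian sends the function built from
`(∂_s^k H, ∂_s^k G)` to `2m - 2 - 4k` times the one built from `(∂_s^{k+1} H, ∂_s^{k+1} G)`, and the
Dirac operator leaves only a multiple of `∂_s^k G`. Hence `∂̄ Δ^k f = c ∂_s^k G` (`diracLap_axial`),
where `c` is a product of factors that are nonzero for `2k + 1 < m`.

The theorem thus reduces to solving `∂_s^k G = 0`. The `G` of `zⁿ` has degree `⌊(n-1)/2⌋` in `s`, so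
powers up to `z^{2k}` are solutions. Conversely, the system forces `∂_s^k H` to be constant;
subtracting a multiple of `z^{2k}` makes `∂_s^{k-1} G` constant, subtracting a multiple of
`z^{2k-1}` kills that, and induction on `k` applies (`IsCRPair.exists_eq_sum_powPair`). This
identifies `f` near one point off the real axis. The identity theorem and the stem symmetry carry
the formula to all of `D`. -/

namespace SliceClifford

/-! ### Calculus in the variables `(α, s)` and the Cauchy-Riemann system there. -/

section CRPair

variable {V : Type*} [NormedAddCommGroup V] [NormedSpace ℝ V]

/-- The partial derivative of a function of `(α, s)` in `α`. -/
def dFst (h : ℝ × ℝ → V) : ℝ × ℝ → V := fun p => fderiv ℝ h p (1, 0)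

/-- The partial derivative of a function of `(α, s)` in `s`. -/
def dSnd (h : ℝ × ℝ → V) : ℝ × ℝ → V := fun p => fderiv ℝ h p (0, 1)

theorem fderiv_eq_dFst_dSnd (h : ℝ × ℝ → V) (p v : ℝ × ℝ) :
    fderiv ℝ h p v = v.1 • dFst h p + v.2 • dSnd h p := by
  have hv : v = v.1 • ((1, 0) : ℝ × ℝ) + v.2 • ((0, 1) : ℝ × ℝ) := by ext <;> simp
  conv_lhs => rw [hv, map_add, map_smul, map_smul]
  rfl

theorem differentiableAt_of_contDiffOn {h : ℝ × ℝ → V} {W : Set (ℝ × ℝ)} (hW : IsOpen W)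
    (hh : ContDiffOn ℝ ∞ h W) {p : ℝ × ℝ} (hp : p ∈ W) : DifferentiableAt ℝ h p :=
  (hh.contDiffAt (hW.mem_nhds hp)).differentiableAt (by simp)

theorem contDiffOn_dFst {h : ℝ × ℝ → V} {W : Set (ℝ × ℝ)} (hW : IsOpen W)
    (hh : ContDiffOn ℝ ∞ h W) : ContDiffOn ℝ ∞ (dFst h) W :=
  (hh.fderiv_of_isOpen hW (m := ∞) (by simp)).clm_apply contDiffOn_const

theorem contDiffOn_dSnd {h : ℝ × ℝ → V} {W : Set (ℝ × ℝ)} (hW : IsOpen W)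
    (hh : ContDiffOn ℝ ∞ h W) : ContDiffOn ℝ ∞ (dSnd h) W :=
  (hh.fderiv_of_isOpen hW (m := ∞) (by simp)).clm_apply contDiffOn_const

theorem contDiffOn_dSnd_iterate {h : ℝ × ℝ → V} {W : Set (ℝ × ℝ)} (hW : IsOpen W)
    (hh : ContDiffOn ℝ ∞ h W) (k : ℕ) : ContDiffOn ℝ ∞ (dSnd^[k] h) W := by
  induction k with
  | zero => simpa
  | succ k ih => rw [Function.iterate_succ_apply']; exact contDiffOn_dSnd hW ih

theorem eqOn_dFst {h h' : ℝ × ℝ → V} {W : Set (ℝ × ℝ)} (hW : IsOpen W) (e : Set.EqOn h h' W) :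
    Set.EqOn (dFst h) (dFst h') W := fun p hp => by
  simp only [dFst, (e.eventuallyEq_of_mem (hW.mem_nhds hp)).fderiv_eq]

theorem eqOn_dSnd {h h' : ℝ × ℝ → V} {W : Set (ℝ × ℝ)} (hW : IsOpen W) (e : Set.EqOn h h' W) :
    Set.EqOn (dSnd h) (dSnd h') W := fun p hp => by
  simp only [dSnd, (e.eventuallyEq_of_mem (hW.mem_nhds hp)).fderiv_eq]

theorem dFst_dSnd_comm {h : ℝ × ℝ → V} {W : Set (ℝ × ℝ)} (hW : IsOpen W)
    (hh : ContDiffOn ℝ ∞ h W) {p : ℝ × ℝ} (hp : p ∈ W) :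
    dFst (dSnd h) p = dSnd (dFst h) p := by
  have hc : ContDiffAt ℝ ∞ h p := hh.contDiffAt (hW.mem_nhds hp)
  have hd : DifferentiableAt ℝ (fderiv ℝ h) p :=
    (hc.fderiv_right (m := ∞) (by simp)).differentiableAt (by simp)
  have key : ∀ v w : ℝ × ℝ, fderiv ℝ (fun q => fderiv ℝ h q v) p w = fderiv ℝ (fderiv ℝ h) p w v := by
    intro v w
    rw [fderiv_clm_apply hd (differentiableAt_const v)]
    simp
  have hs : IsSymmSndFDerivAt ℝ h p := hc.isSymmSndFDerivAt (by simpa using WithTop.coe_le_coe.2 (le_top (a := (2 : ℕ∞))))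
  unfold dFst dSnd
  rw [key, key]
  exact hs _ _

theorem dFst_add {f g : ℝ × ℝ → V} {p : ℝ × ℝ} (hf : DifferentiableAt ℝ f p)
    (hg : DifferentiableAt ℝ g p) : dFst (fun q => f q + g q) p = dFst f p + dFst g p := by
  simp [dFst, fderiv_fun_add hf hg]

theorem dSnd_add {f g : ℝ × ℝ → V} {p : ℝ × ℝ} (hf : DifferentiableAt ℝ f p)
    (hg : DifferentiableAt ℝ g p) : dSnd (fun q => f q + g q) p = dSnd f p + dSnd g p := by
  simp [dSnd, fderiv_fun_add hf hg]

theorem dFst_sub {f g : ℝ × ℝ → V} {p : ℝ × ℝ} (hf : DifferentiableAt ℝ f p)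
    (hg : DifferentiableAt ℝ g p) : dFst (fun q => f q - g q) p = dFst f p - dFst g p := by
  simp [dFst, fderiv_fun_sub hf hg]

theorem dSnd_sub {f g : ℝ × ℝ → V} {p : ℝ × ℝ} (hf : DifferentiableAt ℝ f p)
    (hg : DifferentiableAt ℝ g p) : dSnd (fun q => f q - g q) p = dSnd f p - dSnd g p := by
  simp [dSnd, fderiv_fun_sub hf hg]

theorem dSnd_const_smul {f : ℝ × ℝ → V} {p : ℝ × ℝ} (c : ℝ) (hf : DifferentiableAt ℝ f p) :
    dSnd (fun q => c • f q) p = c • dSnd f p := by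
  simp [dSnd, fderiv_fun_const_smul hf]

theorem dFst_const_smul {f : ℝ × ℝ → V} {p : ℝ × ℝ} (c : ℝ) (hf : DifferentiableAt ℝ f p) :
    dFst (fun q => c • f q) p = c • dFst f p := by
  simp [dFst, fderiv_fun_const_smul hf]

theorem dFst_fst_smul {f : ℝ × ℝ → V} {p : ℝ × ℝ} (hf : DifferentiableAt ℝ f p) :
    dFst (fun q => q.1 • f q) p = f p + p.1 • dFst f p := by
  simp [dFst, fderiv_fun_smul differentiableAt_fst hf, fderiv_fst, add_comm]

theorem dSnd_fst_smul {f : ℝ × ℝ → V} {p : ℝ × ℝ} (hf : DifferentiableAt ℝ f p) :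
    dSnd (fun q => q.1 • f q) p = p.1 • dSnd f p := by
  simp [dSnd, fderiv_fun_smul differentiableAt_fst hf, fderiv_fst]

theorem dFst_snd_smul {f : ℝ × ℝ → V} {p : ℝ × ℝ} (hf : DifferentiableAt ℝ f p) :
    dFst (fun q => q.2 • f q) p = p.2 • dFst f p := by
  simp [dFst, fderiv_fun_smul differentiableAt_snd hf, fderiv_snd]

theorem dSnd_snd_smul {f : ℝ × ℝ → V} {p : ℝ × ℝ} (hf : DifferentiableAt ℝ f p) :
    dSnd (fun q => q.2 • f q) p = f p + p.2 • dSnd f p := by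
  simp [dSnd, fderiv_fun_smul differentiableAt_snd hf, fderiv_snd, add_comm]

theorem eqOn_dSnd_iterate_sub {f g : ℝ × ℝ → V} {W : Set (ℝ × ℝ)} (hW : IsOpen W)
    (hf : ContDiffOn ℝ ∞ f W) (hg : ContDiffOn ℝ ∞ g W) (k : ℕ) :
    Set.EqOn (dSnd^[k] (fun q => f q - g q)) (fun q => dSnd^[k] f q - dSnd^[k] g q) W := by
  induction k with
  | zero => intro p _; rfl
  | succ k ih =>
    intro p hp
    simp only [Function.iterate_succ_apply']
    rw [eqOn_dSnd hW ih hp,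
      dSnd_sub (differentiableAt_of_contDiffOn hW (contDiffOn_dSnd_iterate hW hf k) hp)
        (differentiableAt_of_contDiffOn hW (contDiffOn_dSnd_iterate hW hg k) hp)]

theorem eqOn_dSnd_iterate_add {f g : ℝ × ℝ → V} {W : Set (ℝ × ℝ)} (hW : IsOpen W)
    (hf : ContDiffOn ℝ ∞ f W) (hg : ContDiffOn ℝ ∞ g W) (k : ℕ) :
    Set.EqOn (dSnd^[k] (fun q => f q + g q)) (fun q => dSnd^[k] f q + dSnd^[k] g q) W := by
  induction k with
  | zero => intro p _; rfl
  | succ k ih =>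
    intro p hp
    simp only [Function.iterate_succ_apply']
    rw [eqOn_dSnd hW ih hp,
      dSnd_add (differentiableAt_of_contDiffOn hW (contDiffOn_dSnd_iterate hW hf k) hp)
        (differentiableAt_of_contDiffOn hW (contDiffOn_dSnd_iterate hW hg k) hp)]

theorem dSnd_iterate_fst_smul {f : ℝ × ℝ → V} (hf : ContDiff ℝ ∞ f) (k : ℕ) :
    dSnd^[k] (fun q => q.1 • f q) = fun q => q.1 • dSnd^[k] f q := by
  induction k with
  | zero => rfl
  | succ k ih =>
    ext p
    simp only [Function.iterate_succ_apply']
    rw [ih, dSnd_fst_smul (differentiableAt_of_contDiffOn isOpen_univ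
      (contDiffOn_dSnd_iterate isOpen_univ hf.contDiffOn k) trivial)]

/-- Leibniz rule: since `s` is linear, only two terms survive. -/
theorem dSnd_iterate_succ_snd_smul {f : ℝ × ℝ → V} (hf : ContDiff ℝ ∞ f) (k : ℕ) :
    dSnd^[k + 1] (fun q => q.2 • f q) =
      fun q => q.2 • dSnd^[k + 1] f q + ((k : ℝ) + 1) • dSnd^[k] f q := by
  have hd : ∀ j p, DifferentiableAt ℝ (dSnd^[j] f) p := fun j p =>
    differentiableAt_of_contDiffOn isOpen_univ
      (contDiffOn_dSnd_iterate isOpen_univ hf.contDiffOn j) trivial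
  induction k with
  | zero =>
    ext p
    simp [dSnd_snd_smul (f := f) (hd 0 p), add_comm]
  | succ k ih =>
    ext p
    rw [Function.iterate_succ_apply', ih,
      dSnd_add (differentiableAt_snd.fun_smul (hd _ p)) ((hd _ p).fun_const_smul _),
      dSnd_snd_smul (hd _ p), dSnd_const_smul _ (hd _ p)]
    simp only [← Function.iterate_succ_apply' dSnd]
    push_cast
    module

/-- The equations satisfied by `H(α, s) = F₀(α + i√s)` and `G(α, s) = F₁(α + i√s)/√s` for a
holomorphic `F₀ + i F₁`: the Cauchy-Riemann equations in the variables `α` and `s = β²`. -/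
structure IsCRPair (W : Set (ℝ × ℝ)) (H G : ℝ × ℝ → V) : Prop where
  smooth₀ : ContDiffOn ℝ ∞ H W
  smooth₁ : ContDiffOn ℝ ∞ G W
  dFst_eq : ∀ p ∈ W, dFst H p = G p + (2 * p.2) • dSnd G p
  dSnd_eq : ∀ p ∈ W, dSnd H p = -(1 / 2 : ℝ) • dFst G p

namespace IsCRPair

variable {W : Set (ℝ × ℝ)} {H G : ℝ × ℝ → V}

theorem mono {W' : Set (ℝ × ℝ)} (h : IsCRPair W H G) (hs : W' ⊆ W) : IsCRPair W' H G :=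
  ⟨h.smooth₀.mono hs, h.smooth₁.mono hs, fun p hp => h.dFst_eq p (hs hp),
    fun p hp => h.dSnd_eq p (hs hp)⟩

theorem sub {H' G' : ℝ × ℝ → V} (hW : IsOpen W) (h : IsCRPair W H G) (h' : IsCRPair W H' G') :
    IsCRPair W (fun q => H q - H' q) (fun q => G q - G' q) := by
  refine ⟨h.smooth₀.sub h'.smooth₀, h.smooth₁.sub h'.smooth₁, fun p hp => ?_, fun p hp => ?_⟩
  all_goals
    have d1 := differentiableAt_of_contDiffOn hW h.smooth₀ hp
    have d2 := differentiableAt_of_contDiffOn hW h.smooth₁ hp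
    have d3 := differentiableAt_of_contDiffOn hW h'.smooth₀ hp
    have d4 := differentiableAt_of_contDiffOn hW h'.smooth₁ hp
  · rw [dFst_sub d1 d3, dSnd_sub d2 d4, h.dFst_eq p hp, h'.dFst_eq p hp]
    module
  · rw [dSnd_sub d1 d3, dFst_sub d2 d4, h.dSnd_eq p hp, h'.dSnd_eq p hp]
    module

theorem add {H' G' : ℝ × ℝ → V} (hW : IsOpen W) (h : IsCRPair W H G) (h' : IsCRPair W H' G') :
    IsCRPair W (fun q => H q + H' q) (fun q => G q + G' q) := by
  refine ⟨h.smooth₀.add h'.smooth₀, h.smooth₁.add h'.smooth₁, fun p hp => ?_, fun p hp => ?_⟩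
  all_goals
    have d1 := differentiableAt_of_contDiffOn hW h.smooth₀ hp
    have d2 := differentiableAt_of_contDiffOn hW h.smooth₁ hp
    have d3 := differentiableAt_of_contDiffOn hW h'.smooth₀ hp
    have d4 := differentiableAt_of_contDiffOn hW h'.smooth₁ hp
  · rw [dFst_add d1 d3, dSnd_add d2 d4, h.dFst_eq p hp, h'.dFst_eq p hp]
    module
  · rw [dSnd_add d1 d3, dFst_add d2 d4, h.dSnd_eq p hp, h'.dSnd_eq p hp]
    module

/-- Each `∂_s` applied to `2s ∂_s^{k+1} G` releases another `2 ∂_s^{k+1} G`, so the coefficient of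
the lower term grows as `1, 3, 5, …`. This growth is why the constants in the Laplacian and Dirac
formulas depend on `k`. -/
theorem iterate (hW : IsOpen W) (h : IsCRPair W H G) (k : ℕ) :
    ∀ p ∈ W, dFst (dSnd^[k] H) p =
        (2 * (k : ℝ) + 1) • dSnd^[k] G p + (2 * p.2) • dSnd^[k + 1] G p ∧
      dSnd^[k + 1] H p = -(1 / 2 : ℝ) • dFst (dSnd^[k] G) p := by
  have dG : ∀ j, ∀ p ∈ W, DifferentiableAt ℝ (dSnd^[j] G) p := fun j p hp =>
    differentiableAt_of_contDiffOn hW (contDiffOn_dSnd_iterate hW h.smooth₁ j) hp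
  induction k with
  | zero =>
    intro p hp
    simpa only [Function.iterate_zero, id, zero_add, Function.iterate_one, Nat.cast_zero, mul_zero,
      one_smul] using And.intro (h.dFst_eq p hp) (h.dSnd_eq p hp)
  | succ k ih =>
    intro p hp
    constructor
    · rw [Function.iterate_succ_apply', dFst_dSnd_comm hW (contDiffOn_dSnd_iterate hW h.smooth₀ k) hp,
        eqOn_dSnd hW (fun q hq => (ih q hq).1) hp]
      simp only [mul_smul]
      have d2 : DifferentiableAt ℝ (fun q : ℝ × ℝ => q.2 • dSnd^[k + 1] G q) p :=
        differentiableAt_snd.fun_smul (dG _ p hp)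
      rw [dSnd_add ((dG _ p hp).fun_const_smul _) (d2.fun_const_smul _), dSnd_const_smul _ (dG _ p hp),
        dSnd_const_smul _ d2, dSnd_snd_smul (dG _ p hp)]
      simp only [← Function.iterate_succ_apply' dSnd]
      push_cast
      module
    · have d1 : DifferentiableAt ℝ (dFst (dSnd^[k] G)) p :=
        differentiableAt_of_contDiffOn hW
          (contDiffOn_dFst hW (contDiffOn_dSnd_iterate hW h.smooth₁ k)) hp
      rw [Function.iterate_succ_apply', eqOn_dSnd hW (fun q hq => (ih q hq).2) hp,
        dSnd_const_smul _ d1, ← dFst_dSnd_comm hW (contDiffOn_dSnd_iterate hW h.smooth₁ k) hp,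
        ← Function.iterate_succ_apply' dSnd]

/-- Multiplication of `F₀ + i F₁` by `z`. -/
theorem mul_z (hW : IsOpen W) (h : IsCRPair W H G) :
    IsCRPair W (fun q => q.1 • H q - q.2 • G q) (fun q => q.1 • G q + H q) := by
  refine ⟨(contDiffOn_fst.smul h.smooth₀).sub (contDiffOn_snd.smul h.smooth₁),
    (contDiffOn_fst.smul h.smooth₁).add h.smooth₀, fun p hp => ?_, fun p hp => ?_⟩
  all_goals
    have d1 := differentiableAt_of_contDiffOn hW h.smooth₀ hp
    have d2 := differentiableAt_of_contDiffOn hW h.smooth₁ hp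
    have e1 := h.dFst_eq p hp
    have e2 := h.dSnd_eq p hp
  · rw [dFst_sub (differentiableAt_fst.fun_smul d1) (differentiableAt_snd.fun_smul d2),
      dSnd_add (differentiableAt_fst.fun_smul d2) d1, dFst_fst_smul d1, dFst_snd_smul d2,
      dSnd_fst_smul d2, e1, e2]
    module
  · rw [dSnd_sub (differentiableAt_fst.fun_smul d1) (differentiableAt_snd.fun_smul d2),
      dFst_add (differentiableAt_fst.fun_smul d2) d1, dSnd_fst_smul d1, dSnd_snd_smul d2,
      dFst_fst_smul d2, e1, e2]
    module

end IsCRPair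

/-! ### Monomials in `z` and their degrees in `s`. -/

/-- The pair `(H, G)` attached to `F(z) = zⁿ a`. -/
def powPair (a : V) : ℕ → (ℝ × ℝ → V) × (ℝ × ℝ → V)
  | 0 => (fun _ => a, fun _ => 0)
  | n + 1 => (fun q => q.1 • (powPair a n).1 q - q.2 • (powPair a n).2 q,
      fun q => q.1 • (powPair a n).2 q + (powPair a n).1 q)

theorem isCRPair_powPair (a : V) (n : ℕ) : IsCRPair Set.univ (powPair a n).1 (powPair a n).2 := by
  induction n with
  | zero =>
    refine ⟨contDiffOn_const, contDiffOn_const, fun p _ => ?_, fun p _ => ?_⟩ <;>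
      simp [powPair, dFst, dSnd]
  | succ n ih => exact ih.mul_z isOpen_univ

theorem contDiff_powPair_fst (a : V) (n : ℕ) : ContDiff ℝ ∞ (powPair a n).1 :=
  contDiffOn_univ.1 (isCRPair_powPair a n).smooth₀

theorem contDiff_powPair_snd (a : V) (n : ℕ) : ContDiff ℝ ∞ (powPair a n).2 :=
  contDiffOn_univ.1 (isCRPair_powPair a n).smooth₁

theorem dSnd_zero : dSnd (fun _ => 0 : ℝ × ℝ → V) = fun _ => 0 := by
  ext p; simp [dSnd]

theorem dSnd_iterate_zero (k : ℕ) : dSnd^[k] (fun _ => 0 : ℝ × ℝ → V) = fun _ => 0 :=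
  Function.iterate_fixed dSnd_zero k

theorem dSnd_iterate_powPair_succ_snd (a : V) (n j : ℕ) (p : ℝ × ℝ) :
    dSnd^[j] (powPair a (n + 1)).2 p =
      p.1 • dSnd^[j] (powPair a n).2 p + dSnd^[j] (powPair a n).1 p := by
  have h := eqOn_dSnd_iterate_add (f := fun q => q.1 • (powPair a n).2 q)
    (g := (powPair a n).1) isOpen_univ
    (contDiff_fst.smul (contDiff_powPair_snd a n)).contDiffOn
    (contDiff_powPair_fst a n).contDiffOn j (Set.mem_univ p)
  rw [powPair, h]
  simp only [dSnd_iterate_fst_smul (contDiff_powPair_snd a n)]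

theorem dSnd_iterate_succ_powPair_succ_fst (a : V) (n j : ℕ) (p : ℝ × ℝ) :
    dSnd^[j + 1] (powPair a (n + 1)).1 p =
      p.1 • dSnd^[j + 1] (powPair a n).1 p - p.2 • dSnd^[j + 1] (powPair a n).2 p -
        ((j : ℝ) + 1) • dSnd^[j] (powPair a n).2 p := by
  have h := eqOn_dSnd_iterate_sub (f := fun q => q.1 • (powPair a n).1 q)
    (g := fun q => q.2 • (powPair a n).2 q) isOpen_univ
    (contDiff_fst.smul (contDiff_powPair_fst a n)).contDiffOn
    (contDiff_snd.smul (contDiff_powPair_snd a n)).contDiffOn (j + 1) (Set.mem_univ p)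
  rw [powPair, h]
  simp only [dSnd_iterate_fst_smul (contDiff_powPair_fst a n),
    dSnd_iterate_succ_snd_smul (contDiff_powPair_snd a n)]
  module

/-- Expanding `(α + i√s)ⁿ`, its real part has degree `⌊n/2⌋` in `s`, and its imaginary part divided
by `√s` has degree `⌊(n-1)/2⌋`. -/
theorem dSnd_iterate_powPair_eq_zero (a : V) (n : ℕ) :
    ∀ j, (n ≤ 2 * j → ∀ p, dSnd^[j] (powPair a n).2 p = 0) ∧
      (n < 2 * j → ∀ p, dSnd^[j] (powPair a n).1 p = 0) := by
  induction n with
  | zero =>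
    refine fun j => ⟨fun _ p => ?_, fun hj p => ?_⟩
    · simp [powPair, dSnd_iterate_zero]
    · obtain ⟨i, rfl⟩ : ∃ i, j = i + 1 := ⟨j - 1, by omega⟩
      have : dSnd (fun _ => a : ℝ × ℝ → V) = fun _ => 0 := by ext p; simp [dSnd]
      simp [powPair, Function.iterate_succ_apply, this, dSnd_iterate_zero]
  | succ n ih =>
    refine fun j => ⟨fun hj p => ?_, fun hj p => ?_⟩
    · rw [dSnd_iterate_powPair_succ_snd, (ih j).1 (by omega), (ih j).2 (by omega)]
      simp
    · obtain ⟨i, rfl⟩ : ∃ i, j = i + 1 := ⟨j - 1, by omega⟩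
      rw [dSnd_iterate_succ_powPair_succ_fst, (ih _).1 (by omega), (ih _).2 (by omega),
        (ih i).1 (by omega)]
      simp

/-- In both cases the leading term in `s` is `(-s)^j a`. The two values normalise the monomials that
are subtracted in `IsCRPair.exists_eq_sum_powPair`. -/
theorem dSnd_iterate_powPair_top (a : V) (j : ℕ) :
    (∀ p, dSnd^[j] (powPair a (2 * j)).1 p = ((-1) ^ j * (j.factorial : ℝ)) • a) ∧
      ∀ p, dSnd^[j] (powPair a (2 * j + 1)).2 p = ((-1) ^ j * (j.factorial : ℝ)) • a := by
  have snd_of_fst : ∀ i, (∀ p, dSnd^[i] (powPair a (2 * i)).1 p =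
      ((-1) ^ i * (i.factorial : ℝ)) • a) →
      ∀ p, dSnd^[i] (powPair a (2 * i + 1)).2 p = ((-1) ^ i * (i.factorial : ℝ)) • a := by
    intro i hi p
    rw [dSnd_iterate_powPair_succ_snd, hi,
      (dSnd_iterate_powPair_eq_zero a (2 * i) i).1 le_rfl]
    simp
  have fst : ∀ p, dSnd^[j] (powPair a (2 * j)).1 p = ((-1) ^ j * (j.factorial : ℝ)) • a := by
    induction j with
    | zero => simp [powPair]
    | succ j ih =>
      intro p
      rw [show 2 * (j + 1) = 2 * j + 1 + 1 by ring, dSnd_iterate_succ_powPair_succ_fst,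
        snd_of_fst j ih, (dSnd_iterate_powPair_eq_zero a (2 * j + 1) (j + 1)).1 (by omega),
        (dSnd_iterate_powPair_eq_zero a (2 * j + 1) (j + 1)).2 (by omega), Nat.factorial_succ]
      push_cast
      module
  exact ⟨fst, snd_of_fst j fst⟩

theorem isCRPair_sum_powPair (a : ℕ → V) (k : ℕ) : ∀ N ≤ 2 * k + 1,
    IsCRPair Set.univ (fun p => ∑ n ∈ Finset.range N, (powPair (a n) n).1 p)
      (fun p => ∑ n ∈ Finset.range N, (powPair (a n) n).2 p) ∧
    ∀ p, dSnd^[k] (fun p => ∑ n ∈ Finset.range N, (powPair (a n) n).2 p) p = 0 := by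
  intro N
  induction N with
  | zero =>
    intro _
    simp only [Finset.range_zero, Finset.sum_empty, dSnd_iterate_zero, implies_true, and_true]
    exact isCRPair_powPair (0 : V) 0
  | succ N ih =>
    intro hN
    obtain ⟨h, h0⟩ := ih (by omega)
    simp only [Finset.sum_range_succ]
    refine ⟨h.add isOpen_univ (isCRPair_powPair _ _), fun p => ?_⟩
    rw [eqOn_dSnd_iterate_add isOpen_univ h.smooth₁ (isCRPair_powPair _ _).smooth₁ k
      (Set.mem_univ p)]
    simp only [h0, (dSnd_iterate_powPair_eq_zero (a N) N k).1 (by omega), add_zero]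

/-- Returns from `(α, s)` to `z`; the second identity is multiplied by `z.im`, so it also holds on
the real axis. -/
theorem powPair_re_im (a : V) (n : ℕ) (z : ℂ) :
    (powPair a n).1 (z.re, z.im ^ 2) = (z ^ n).re • a ∧
      z.im • (powPair a n).2 (z.re, z.im ^ 2) = (z ^ n).im • a := by
  induction n with
  | zero => simp [powPair]
  | succ n ih =>
    simp only [powPair, pow_succ' z, Complex.mul_re, Complex.mul_im, smul_add, pow_two, mul_smul,
      add_smul, sub_smul, smul_comm _ z.re] at ih ⊢
    simp only [ih.1, ih.2, and_self]

/-! ### Integration of the system when `∂_s^k G = 0`. -/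

theorem eqOn_const_of_partials_eq_zero {U : Set (ℝ × ℝ)} (hU : IsOpen U) (hc : IsPreconnected U)
    {h : ℝ × ℝ → V} (hh : ContDiffOn ℝ ∞ h U) (h1 : ∀ p ∈ U, dFst h p = 0)
    (h2 : ∀ p ∈ U, dSnd h p = 0) : ∃ c, ∀ p ∈ U, h p = c :=
  hU.exists_is_const_of_fderiv_eq_zero hc
    (fun p hp => (differentiableAt_of_contDiffOn hU hh hp).differentiableWithinAt) fun p hp => by
      ext <;> simp [fderiv_eq_dFst_dSnd, h1 p hp, h2 p hp]

/-- If `G` is a polynomial of degree less than `k` in `s`, then `H` and `G` come from a polynomial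
of degree at most `2k` in `z`. -/
theorem IsCRPair.exists_eq_sum_powPair {U : Set (ℝ × ℝ)} (hU : IsOpen U) (hc : IsPreconnected U)
    (k : ℕ) : ∀ {H G : ℝ × ℝ → V}, IsCRPair U H G → (∀ p ∈ U, dSnd^[k] G p = 0) →
      ∃ a : ℕ → V, ∀ p ∈ U, H p = ∑ n ∈ Finset.range (2 * k + 1), (powPair (a n) n).1 p ∧
        G p = ∑ n ∈ Finset.range (2 * k + 1), (powPair (a n) n).2 p := by
  -- By `IsCRPair.iterate`, both partials of `∂_s^k H` are expressed through `∂_s^k G` and its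
  -- derivatives, all zero on the open set `U`. So `∂_s^k H` is constant, and it is written as the
  -- contribution of `z^{2k} a`.
  have kill : ∀ (k : ℕ) {H G : ℝ × ℝ → V}, IsCRPair U H G → (∀ p ∈ U, dSnd^[k] G p = 0) →
      ∃ a : V, ∀ p ∈ U, dSnd^[k] H p = ((-1) ^ k * (k.factorial : ℝ)) • a := by
    intro k H G h h0
    have z1 := eqOn_dFst (h' := fun _ => 0) hU h0
    have z2 := eqOn_dSnd (h' := fun _ => 0) hU h0
    obtain ⟨c, hc⟩ := eqOn_const_of_partials_eq_zero hU hc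
      (contDiffOn_dSnd_iterate hU h.smooth₀ k)
      (fun p hp => by
        rw [(h.iterate hU k p hp).1, h0 p hp, Function.iterate_succ_apply', z2 hp]
        simp [dSnd])
      (fun p hp => by
        rw [← Function.iterate_succ_apply' dSnd, (h.iterate hU k p hp).2, z1 hp]
        simp [dFst])
    refine ⟨((-1) ^ k * (k.factorial : ℝ))⁻¹ • c, fun p hp => ?_⟩
    rw [smul_inv_smul₀ (mul_ne_zero (by simp) (by positivity)), hc p hp]
  induction k with
  | zero =>
    intro H G h h0
    obtain ⟨a, ha⟩ := kill 0 h h0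
    refine ⟨fun _ => a, fun p hp => ?_⟩
    have := ha p hp
    have := h0 p hp
    simp_all [powPair]
  | succ k ih =>
    intro H G h h0
    obtain ⟨a, ha⟩ := kill (k + 1) h h0
    -- Subtracting `z^{2k+2} a` kills `∂_s^{k+1} H` and keeps `∂_s^{k+1} G = 0`.
    have hp2 := (isCRPair_powPair a (2 * (k + 1))).mono (Set.subset_univ U)
    have h' := h.sub hU hp2
    have eG := eqOn_dSnd_iterate_sub hU h.smooth₁ hp2.smooth₁ (k + 1)
    have eH := eqOn_dSnd_iterate_sub hU h.smooth₀ hp2.smooth₀ (k + 1)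
    have zG : ∀ p ∈ U, dSnd^[k + 1] (fun q => G q - (powPair a (2 * (k + 1))).2 q) p = 0 :=
      fun p hp => by
        rw [eG hp]
        simp [h0 p hp, (dSnd_iterate_powPair_eq_zero a (2 * (k + 1)) (k + 1)).1 le_rfl]
    have zH : ∀ p ∈ U, dSnd^[k + 1] (fun q => H q - (powPair a (2 * (k + 1))).1 q) p = 0 :=
      fun p hp => by
        rw [eH hp]
        simp [ha p hp, (dSnd_iterate_powPair_top a (k + 1)).1]
    -- Now `∂_α ∂_s^k G = -2 ∂_s^{k+1} H = 0` as well, so `∂_s^k G` is a constant `d`.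
    obtain ⟨d, hd⟩ := eqOn_const_of_partials_eq_zero hU hc
      (contDiffOn_dSnd_iterate hU h'.smooth₁ k)
      (fun p hp => by
        have := (h'.iterate hU k p hp).2
        rw [zH p hp] at this
        simpa using this.symm)
      (fun p hp => by rw [← Function.iterate_succ_apply' dSnd, zG p hp])
    -- Chosen so that `z^{2k+1} b` contributes exactly `d` to `∂_s^k G`; what remains satisfies the
    -- induction hypothesis.
    set b := ((-1) ^ k * (k.factorial : ℝ))⁻¹ • d with hb
    have hp1 := (isCRPair_powPair b (2 * k + 1)).mono (Set.subset_univ U)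
    have h'' := h'.sub hU hp1
    obtain ⟨a', ha'⟩ := ih h'' fun p hp => by
      rw [eqOn_dSnd_iterate_sub hU h'.smooth₁ hp1.smooth₁ k hp]
      simp only [hd p hp, (dSnd_iterate_powPair_top b k).2]
      rw [hb, smul_inv_smul₀ (mul_ne_zero (by simp) (by positivity)), sub_self]
    refine ⟨fun n => if n = 2 * k + 2 then a else if n = 2 * k + 1 then b else a' n,
      fun p hp => ?_⟩
    have hn : ∀ n ∈ Finset.range (2 * k + 1),
        (if n = 2 * k + 2 then a else if n = 2 * k + 1 then b else a' n) = a' n := by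
      intro n hn
      rw [Finset.mem_range] at hn
      rw [if_neg (by omega), if_neg (by omega)]
    rw [show 2 * (k + 1) + 1 = 2 * k + 1 + 1 + 1 by ring]
    simp only [Finset.sum_range_succ _ (2 * k + 1 + 1), Finset.sum_range_succ _ (2 * k + 1)]
    constructor
    · rw [Finset.sum_congr (g := fun n => (powPair (a' n) n).1 p) rfl fun n h => by rw [hn n h],
        ← (ha' p hp).1]
      simp [mul_add]
    · rw [Finset.sum_congr (g := fun n => (powPair (a' n) n).2 p) rfl fun n h => by rw [hn n h],
        ← (ha' p hp).2]
      simp [mul_add]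

end CRPair

/-! ### The Laplacian and the Dirac operator on functions `H + y G`. -/

section Axial

variable {m : ℕ}

instance instFiniteDimensionalRC : FiniteDimensional ℝ (RC m) :=
  Module.Finite.of_basis (basisRC m)

/-- The vector part `x₁ e₁ + ⋯ + xₘ eₘ` of a paravector. -/
def vecPart : EuclideanSpace ℝ (Fin (m + 1)) →L[ℝ] RC m :=
  LinearMap.toContinuousLinearMap
    (∑ j : Fin m, ((EuclideanSpace.proj j.succ : EuclideanSpace ℝ (Fin (m + 1)) →L[ℝ] ℝ) :
      EuclideanSpace ℝ (Fin (m + 1)) →ₗ[ℝ] ℝ).smulRight (e j))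

theorem vecPart_apply (x : EuclideanSpace ℝ (Fin (m + 1))) :
    vecPart x = ∑ j : Fin m, x j.succ • (e j : RC m) := by
  simp [vecPart]

theorem paravector_eq (x : EuclideanSpace ℝ (Fin (m + 1))) :
    paravector x = algebraMap ℝ (RC m) (x 0) + vecPart x := by
  rw [paravector, vecPart_apply]

/-- The pair `(α, β²)` of a paravector `α + Jβ`. -/
def axisPt (x : EuclideanSpace ℝ (Fin (m + 1))) : ℝ × ℝ := (x 0, ∑ j : Fin m, x j.succ ^ 2)

theorem vecPart_eq_ι (x : EuclideanSpace ℝ (Fin (m + 1))) :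
    vecPart x = CliffordAlgebra.ι (negSq m) (fun j => x j.succ) := by
  rw [vecPart_apply]
  simp only [e, ← map_smul, ← map_sum]
  congr 1
  ext i
  simp [Finset.sum_apply, Pi.single_apply]

theorem vecPart_mul_self (x : EuclideanSpace ℝ (Fin (m + 1))) :
    vecPart x * vecPart x = algebraMap ℝ (RC m) (-(axisPt x).2) := by
  rw [vecPart_eq_ι, CliffordAlgebra.ι_sq_scalar]
  refine congrArg (algebraMap ℝ (RC m)) ?_
  simp [negSq, QuadraticMap.weightedSumSquares_apply, axisPt, pow_two]

theorem e_mul_self (j : Fin m) : (e j : RC m) * e j = -1 := by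
  have h : negSq m (Pi.single j 1) = -1 := by
    simp [negSq, QuadraticMap.weightedSumSquares_apply, Pi.single_apply]
  rw [e, CliffordAlgebra.ι_sq_scalar, h, map_neg, map_one]

theorem star_vecPart (x : EuclideanSpace ℝ (Fin (m + 1))) :
    star (vecPart x) = -vecPart x := by
  rw [vecPart_eq_ι, CliffordAlgebra.star_ι]

/-- Multiplication of `ℝ_m` as a continuous bilinear map. -/
def mulRC : RC m →L[ℝ] RC m →L[ℝ] RC m := (LinearMap.mul ℝ (RC m)).toContinuousBilinearMap

theorem mulRC_apply (a b : RC m) : mulRC a b = a * b := rfl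

theorem vecPart_single_zero : vecPart (EuclideanSpace.single 0 1) = (0 : RC m) := by
  simp [vecPart_apply]

theorem vecPart_single_succ (j : Fin m) : vecPart (EuclideanSpace.single j.succ 1) = (e j : RC m) := by
  rw [vecPart_apply, Finset.sum_eq_single j] <;> simp +contextual [eq_comm]

theorem contDiff_axisPt : ContDiff ℝ ∞ (axisPt : EuclideanSpace ℝ (Fin (m + 1)) → ℝ × ℝ) := by
  unfold axisPt
  fun_prop

theorem fderiv_axisPt (x v : EuclideanSpace ℝ (Fin (m + 1))) :
    fderiv ℝ axisPt x v = (v 0, ∑ j : Fin m, 2 * x j.succ * v j.succ) := by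
  have h0 : ∀ i : Fin (m + 1), HasFDerivAt (fun y : EuclideanSpace ℝ (Fin (m + 1)) => y i)
      (EuclideanSpace.proj i : EuclideanSpace ℝ (Fin (m + 1)) →L[ℝ] ℝ) x := fun i =>
    (EuclideanSpace.proj i : EuclideanSpace ℝ (Fin (m + 1)) →L[ℝ] ℝ).hasFDerivAt
  have h := (h0 0).prodMk (HasFDerivAt.fun_sum (u := Finset.univ)
    fun (j : Fin m) _ => (h0 j.succ).pow 2)
  rw [show (axisPt : EuclideanSpace ℝ (Fin (m + 1)) → ℝ × ℝ) = fun y =>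
    (y 0, ∑ j : Fin m, y j.succ ^ 2) from rfl, h.fderiv]
  simp

theorem fderiv_comp_axisPt {V : Type*} [NormedAddCommGroup V] [NormedSpace ℝ V]
    {h : ℝ × ℝ → V} (x : EuclideanSpace ℝ (Fin (m + 1)))
    (hh : DifferentiableAt ℝ h (axisPt x)) (v : EuclideanSpace ℝ (Fin (m + 1))) :
    fderiv ℝ (fun y => h (axisPt y)) x v =
      v 0 • dFst h (axisPt x) + (∑ j : Fin m, 2 * x j.succ * v j.succ) • dSnd h (axisPt x) := by
  have hd : DifferentiableAt ℝ (axisPt : EuclideanSpace ℝ (Fin (m + 1)) → ℝ × ℝ) x :=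
    contDiff_axisPt.differentiable (by simp) x
  rw [show (fun y => h (axisPt y)) = h ∘ (axisPt : EuclideanSpace ℝ (Fin (m + 1)) → ℝ × ℝ) from rfl,
    fderiv_comp x hh hd, ContinuousLinearMap.comp_apply, fderiv_axisPt, fderiv_eq_dFst_dSnd]

/-- The function `H(α, β²) + y G(α, β²)` of a paravector `α + y` with `β = |y|`. -/
def axial (H G : ℝ × ℝ → RC m) (x : EuclideanSpace ℝ (Fin (m + 1))) : RC m :=
  H (axisPt x) + vecPart x * G (axisPt x)

variable {H G : ℝ × ℝ → RC m}

theorem contDiffOn_axial {W : Set (ℝ × ℝ)} (hH : ContDiffOn ℝ ∞ H W) (hG : ContDiffOn ℝ ∞ G W) :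
    ContDiffOn ℝ ∞ (axial H G) (axisPt ⁻¹' W) := by
  have hm : Set.MapsTo (axisPt : EuclideanSpace ℝ (Fin (m + 1)) → ℝ × ℝ) (axisPt ⁻¹' W) W :=
    fun _ h => h
  exact (hH.comp contDiff_axisPt.contDiffOn hm).add
    (mulRC.isBoundedBilinearMap.contDiff.comp_contDiffOn
      (vecPart.contDiff.contDiffOn.prodMk (hG.comp contDiff_axisPt.contDiffOn hm)))

theorem differentiableAt_comp_axisPt {x : EuclideanSpace ℝ (Fin (m + 1))}
    (hH : DifferentiableAt ℝ H (axisPt x)) : DifferentiableAt ℝ (fun y => H (axisPt y)) x :=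
  DifferentiableAt.comp x hH (contDiff_axisPt.differentiable (by simp) x)

theorem differentiableAt_axial {x : EuclideanSpace ℝ (Fin (m + 1))}
    (hH : DifferentiableAt ℝ H (axisPt x)) (hG : DifferentiableAt ℝ G (axisPt x)) :
    DifferentiableAt ℝ (axial H G) x :=
  (differentiableAt_comp_axisPt hH).fun_add
    (mulRC.hasFDerivAt_of_bilinear vecPart.hasFDerivAt
      (differentiableAt_comp_axisPt hG).hasFDerivAt).differentiableAt

theorem fderiv_axial {x : EuclideanSpace ℝ (Fin (m + 1))}
    (hH : DifferentiableAt ℝ H (axisPt x)) (hG : DifferentiableAt ℝ G (axisPt x))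
    (v : EuclideanSpace ℝ (Fin (m + 1))) :
    fderiv ℝ (axial H G) x v = v 0 • axial (dFst H) (dFst G) x +
      (∑ j : Fin m, 2 * x j.succ * v j.succ) • axial (dSnd H) (dSnd G) x +
        vecPart v * G (axisPt x) := by
  have h := (differentiableAt_comp_axisPt hH).hasFDerivAt.fun_add
    (mulRC.hasFDerivAt_of_bilinear vecPart.hasFDerivAt
      (differentiableAt_comp_axisPt hG).hasFDerivAt)
  refine (DFunLike.congr_fun h.fderiv v).trans ?_
  change fderiv ℝ (fun y => H (axisPt y)) x v +
    (vecPart x * fderiv ℝ (fun y => G (axisPt y)) x v + vecPart v * G (axisPt x)) = _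
  simp only [fderiv_comp_axisPt x hH, fderiv_comp_axisPt x hG, axial, mul_add, mul_smul_comm]
  module

theorem fderiv_axial_zero {x : EuclideanSpace ℝ (Fin (m + 1))}
    (hH : DifferentiableAt ℝ H (axisPt x)) (hG : DifferentiableAt ℝ G (axisPt x)) :
    fderiv ℝ (axial H G) x (EuclideanSpace.single 0 1) = axial (dFst H) (dFst G) x := by
  rw [fderiv_axial hH hG, vecPart_single_zero]
  simp

theorem fderiv_axial_succ {x : EuclideanSpace ℝ (Fin (m + 1))}
    (hH : DifferentiableAt ℝ H (axisPt x)) (hG : DifferentiableAt ℝ G (axisPt x)) (j : Fin m) :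
    fderiv ℝ (axial H G) x (EuclideanSpace.single j.succ 1) =
      (2 * x j.succ) • axial (dSnd H) (dSnd G) x + e j * G (axisPt x) := by
  rw [fderiv_axial hH hG, vecPart_single_succ, Finset.sum_eq_single j] <;>
    simp +contextual [eq_comm]

theorem laplacian_eq_sum_fderiv_fderiv {F : Type*} [NormedAddCommGroup F] [NormedSpace ℝ F]
    {f : EuclideanSpace ℝ (Fin (m + 1)) → F} {x : EuclideanSpace ℝ (Fin (m + 1))}
    (hf : ContDiffAt ℝ ∞ f x) :
    Laplacian.laplacian f x = ∑ i : Fin (m + 1), fderiv ℝ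
      (fun y => fderiv ℝ f y (EuclideanSpace.single i 1)) x (EuclideanSpace.single i 1) := by
  have hd : DifferentiableAt ℝ (fderiv ℝ f) x :=
    (hf.fderiv_right (m := ∞) (by simp)).differentiableAt (by simp)
  rw [InnerProductSpace.laplacian_eq_iteratedFDeriv_orthonormalBasis f
    (EuclideanSpace.basisFun (Fin (m + 1)) ℝ)]
  refine Finset.sum_congr rfl fun i _ => ?_
  rw [iteratedFDeriv_two_apply, fderiv_clm_apply hd (differentiableAt_const _)]
  simp

/-- For a function `h` of `s = |y|²`, the Laplacian in `y` is `2m ∂_s h + 4s ∂_s² h`. For `y G`, the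
cross term of the product rule adds `4 y ∂_s G`, as `y` itself is harmonic. -/
theorem laplacian_axial {W : Set (ℝ × ℝ)} (hW : IsOpen W) (hH : ContDiffOn ℝ ∞ H W)
    (hG : ContDiffOn ℝ ∞ G W) {x : EuclideanSpace ℝ (Fin (m + 1))} (hx : axisPt x ∈ W) :
    Laplacian.laplacian (axial H G) x =
      axial (dFst (dFst H)) (dFst (dFst G)) x + (2 * m : ℝ) • axial (dSnd H) (dSnd G) x +
        (4 * (axisPt x).2) • axial (dSnd (dSnd H)) (dSnd (dSnd G)) x +
        (4 : ℝ) • (vecPart x * dSnd G (axisPt x)) := by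
  have hU : IsOpen ((axisPt : EuclideanSpace ℝ (Fin (m + 1)) → ℝ × ℝ) ⁻¹' W) :=
    hW.preimage contDiff_axisPt.continuous
  have dif : ∀ {h : ℝ × ℝ → RC m}, ContDiffOn ℝ ∞ h W → ∀ p ∈ W, DifferentiableAt ℝ h p :=
    fun h p hp => differentiableAt_of_contDiffOn hW h hp
  have hsH := contDiffOn_dSnd hW hH
  have hsG := contDiffOn_dSnd hW hG
  rw [laplacian_eq_sum_fderiv_fderiv ((contDiffOn_axial hH hG).contDiffAt (hU.mem_nhds hx)),
    Fin.sum_univ_succ]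
  have e0 : (fun y => fderiv ℝ (axial H G) y (EuclideanSpace.single 0 1)) =ᶠ[nhds x]
      axial (dFst H) (dFst G) := by
    filter_upwards [hU.mem_nhds hx] with y hy
    exact fderiv_axial_zero (dif hH _ hy) (dif hG _ hy)
  have ej : ∀ j : Fin m, (fun y => fderiv ℝ (axial H G) y (EuclideanSpace.single j.succ 1))
      =ᶠ[nhds x] fun y => (2 * y j.succ) • axial (dSnd H) (dSnd G) y + mulRC (e j) (G (axisPt y)) := by
    intro j
    filter_upwards [hU.mem_nhds hx] with y hy
    exact fderiv_axial_succ (dif hH _ hy) (dif hG _ hy) j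
  rw [e0.fderiv_eq, fderiv_axial_zero (dif (contDiffOn_dFst hW hH) _ hx)
    (dif (contDiffOn_dFst hW hG) _ hx)]
  have key : ∀ j : Fin m,
      fderiv ℝ (fun y => fderiv ℝ (axial H G) y (EuclideanSpace.single j.succ 1)) x
        (EuclideanSpace.single j.succ 1) = (2 : ℝ) • axial (dSnd H) (dSnd G) x +
        (4 * x j.succ ^ 2) • axial (dSnd (dSnd H)) (dSnd (dSnd G)) x +
        (4 * x j.succ) • (e j * dSnd G (axisPt x)) := by
    intro j
    have hp : HasFDerivAt (fun y : EuclideanSpace ℝ (Fin (m + 1)) => 2 * y j.succ)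
        ((2 : ℝ) • (EuclideanSpace.proj j.succ : EuclideanSpace ℝ (Fin (m + 1)) →L[ℝ] ℝ)) x :=
      (EuclideanSpace.proj j.succ : EuclideanSpace ℝ (Fin (m + 1)) →L[ℝ] ℝ).hasFDerivAt.const_mul 2
    have ha := (differentiableAt_axial (dif hsH _ hx) (dif hsG _ hx)).hasFDerivAt
    have hg := (mulRC (e j)).hasFDerivAt.comp x
      (differentiableAt_comp_axisPt (dif hG _ hx)).hasFDerivAt
    have ht := (hp.fun_smul ha).fun_add hg
    rw [(ej j).fderiv_eq]
    have hf := ht.fderiv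
    simp only [Function.comp_apply] at hf
    rw [hf]
    have hs : (∑ i : Fin m, 2 * x i.succ *
        (EuclideanSpace.single j.succ (1 : ℝ) : EuclideanSpace ℝ (Fin (m + 1))) i.succ) =
        2 * x j.succ := by
      rw [Finset.sum_eq_single j] <;> simp +contextual [eq_comm]
    simp only [add_apply, smul_apply,
      ContinuousLinearMap.smulRight_apply, ContinuousLinearMap.comp_apply,
      fderiv_axial_succ (dif hsH _ hx) (dif hsG _ hx), fderiv_comp_axisPt x (dif hG _ hx), hs,
      mulRC_apply, PiLp.proj_apply]
    simp only [ne_eq, Fin.succ_ne_zero, not_false_eq_true, PiLp.single_eq_of_ne',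
      PiLp.single_eq_same, mul_smul_comm, zero_smul, zero_add, smul_eq_mul]
    module
  have h2 : ∑ j : Fin m, (4 * x j.succ ^ 2) = 4 * (axisPt x).2 := by
    rw [← Finset.mul_sum]; rfl
  have h3 : ∑ j : Fin m, (4 * x j.succ) • (e j * dSnd G (axisPt x)) =
      (4 : ℝ) • (vecPart x * dSnd G (axisPt x)) := by
    simp only [vecPart_apply, Finset.sum_mul, Finset.smul_sum, mul_smul, smul_mul_assoc]
  simp only [key, Finset.sum_add_distrib, ← Finset.sum_smul, h2, h3, Finset.sum_const,
    Finset.card_univ, Fintype.card_fin]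
  module

/-- The system rewrites `∂_α²` in terms of `∂_s`, which cancels the `4s ∂_s²` terms. The remaining
coefficients are `2m - 2(2k+1)` on the `H` side and `2m + 4 - 2(2k+3)` on the `G` side, and they
coincide. -/
theorem IsCRPair.laplacian_axial_iterate {W : Set (ℝ × ℝ)} (hW : IsOpen W) (h : IsCRPair W H G)
    (k : ℕ) {x : EuclideanSpace ℝ (Fin (m + 1))} (hx : axisPt x ∈ W) :
    Laplacian.laplacian (axial (dSnd^[k] H) (dSnd^[k] G)) x =
      (2 * m - 2 - 4 * k : ℝ) • axial (dSnd^[k + 1] H) (dSnd^[k + 1] G) x := by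
  have sH := contDiffOn_dSnd_iterate hW h.smooth₀
  have sG := contDiffOn_dSnd_iterate hW h.smooth₁
  have dif : ∀ {h : ℝ × ℝ → RC m}, ContDiffOn ℝ ∞ h W → DifferentiableAt ℝ h (axisPt x) :=
    fun h => differentiableAt_of_contDiffOn hW h hx
  have hG1 : ∀ j, ∀ p ∈ W, dFst (dSnd^[j] G) p = (-2 : ℝ) • dSnd^[j + 1] H p := fun j p hp => by
    rw [(h.iterate hW j p hp).2]
    module
  have e1 : dFst (dFst (dSnd^[k] G)) (axisPt x) =
      (-2 : ℝ) • ((2 * (k + 1 : ℕ) + 1 : ℝ) • dSnd^[k + 1] G (axisPt x) +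
        (2 * (axisPt x).2) • dSnd^[k + 1 + 1] G (axisPt x)) := by
    rw [eqOn_dFst hW (fun p hp => hG1 k p hp) hx, dFst_const_smul _ (dif (sH _)),
      (h.iterate hW (k + 1) _ hx).1]
  have e2 : dFst (dFst (dSnd^[k] H)) (axisPt x) =
      (2 * (k : ℝ) + 1) • (-2 : ℝ) • dSnd^[k + 1] H (axisPt x) +
        (2 : ℝ) • (axisPt x).2 • (-2 : ℝ) • dSnd^[k + 1 + 1] H (axisPt x) := by
    rw [eqOn_dFst hW (fun p hp => (h.iterate hW k p hp).1) hx]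
    simp only [mul_smul (2 : ℝ)]
    have d2 := differentiableAt_snd.fun_smul (dif (sG (k + 1)))
    rw [dFst_add ((dif (sG k)).fun_const_smul _) (d2.fun_const_smul _),
      dFst_const_smul _ (dif (sG k)), dFst_const_smul _ d2, dFst_snd_smul (dif (sG (k + 1))),
      hG1 _ _ hx, hG1 _ _ hx]
  rw [laplacian_axial hW (sH k) (sG k) hx]
  simp only [← Function.iterate_succ_apply' dSnd]
  simp only [axial, e1, e2, mul_add, mul_smul_comm]
  push_cast
  module

theorem laplacian_iterate_axial {W : Set (ℝ × ℝ)} (hW : IsOpen W) (h : IsCRPair W H G)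
    {g : EuclideanSpace ℝ (Fin (m + 1)) → RC m} (hg : Set.EqOn g (axial H G) (axisPt ⁻¹' W))
    (k : ℕ) : Set.EqOn
      ((fun h : EuclideanSpace ℝ (Fin (m + 1)) → RC m => Laplacian.laplacian h)^[k] g)
      (fun x => (∏ j ∈ Finset.range k, (2 * m - 2 - 4 * j : ℝ)) •
        axial (dSnd^[k] H) (dSnd^[k] G) x) (axisPt ⁻¹' W) := by
  have hU : IsOpen ((axisPt : EuclideanSpace ℝ (Fin (m + 1)) → ℝ × ℝ) ⁻¹' W) :=
    hW.preimage contDiff_axisPt.continuous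
  induction k with
  | zero => intro x hx; simpa using hg hx
  | succ k ih =>
    intro x hx
    rw [Function.iterate_succ_apply']
    have hc : ContDiffAt ℝ 2 (axial (dSnd^[k] H) (dSnd^[k] G)) x :=
      ((contDiffOn_axial (contDiffOn_dSnd_iterate hW h.smooth₀ k)
        (contDiffOn_dSnd_iterate hW h.smooth₁ k)).contDiffAt (hU.mem_nhds hx)).of_le
        (WithTop.coe_le_coe.2 (le_top (a := (2 : ℕ∞))))
    rw [(InnerProductSpace.laplacian_congr_nhds
      (ih.eventuallyEq_of_mem (hU.mem_nhds hx))).eq_of_nhds]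
    have := InnerProductSpace.laplacian_smul
      (∏ j ∈ Finset.range k, (2 * m - 2 - 4 * j : ℝ)) hc
    refine this.trans ?_
    rw [h.laplacian_axial_iterate hW k hx, smul_smul, Finset.prod_range_succ]

/-- The term `-m G` is `∑ e_j² G`, and `-2s ∂_s G` comes from `y² = -s`. -/
theorem dirac_axial {x : EuclideanSpace ℝ (Fin (m + 1))}
    (hH : DifferentiableAt ℝ H (axisPt x)) (hG : DifferentiableAt ℝ G (axisPt x)) :
    dirac (axial H G) x = (1 / 2 : ℝ) • (dFst H (axisPt x) + vecPart x * dFst G (axisPt x) +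
      (2 : ℝ) • (vecPart x * dSnd H (axisPt x)) - (2 * (axisPt x).2) • dSnd G (axisPt x) -
        (m : ℝ) • G (axisPt x)) := by
  have h1 : ∀ j : Fin m, e j * fderiv ℝ (axial H G) x (EuclideanSpace.single j.succ 1) =
      (2 : ℝ) • ((x j.succ • e j) * axial (dSnd H) (dSnd G) x) - G (axisPt x) := by
    intro j
    rw [fderiv_axial_succ hH hG, mul_add, ← mul_assoc, e_mul_self, mul_smul_comm, smul_mul_assoc,
      smul_smul]
    simp [sub_eq_add_neg]
  simp only [dirac, fderiv_axial_zero hH hG, h1, Finset.sum_sub_distrib, ← Finset.smul_sum,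
    ← Finset.sum_mul, ← vecPart_apply]
  simp only [axial, mul_add, ← mul_assoc, vecPart_mul_self, ← Algebra.smul_def, Finset.sum_const,
    Finset.card_univ, Fintype.card_fin]
  module

/-- Inserting the system at level `k` into `dirac_axial`, the terms with a factor `y` cancel, and so
do the terms with a factor `s`. Only `½(2k + 1 - m) ∂_s^k G` survives. -/
theorem diracLap_axial {W : Set (ℝ × ℝ)} (hW : IsOpen W) (h : IsCRPair W H G)
    {g : EuclideanSpace ℝ (Fin (m + 1)) → RC m} (hg : Set.EqOn g (axial H G) (axisPt ⁻¹' W))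
    (k : ℕ) {x : EuclideanSpace ℝ (Fin (m + 1))} (hx : axisPt x ∈ W) :
    diracLap k g x = ((∏ j ∈ Finset.range k, (2 * m - 2 - 4 * j : ℝ)) *
      ((2 * k + 1 - m) / 2 : ℝ)) • dSnd^[k] G (axisPt x) := by
  have hU : IsOpen ((axisPt : EuclideanSpace ℝ (Fin (m + 1)) → ℝ × ℝ) ⁻¹' W) :=
    hW.preimage contDiff_axisPt.continuous
  have dH := differentiableAt_of_contDiffOn hW (contDiffOn_dSnd_iterate hW h.smooth₀ k) hx
  have dG := differentiableAt_of_contDiffOn hW (contDiffOn_dSnd_iterate hW h.smooth₁ k) hx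
  have hf := ((laplacian_iterate_axial hW h hg k).eventuallyEq_of_mem (hU.mem_nhds hx)).fderiv_eq
    (𝕜 := ℝ)
  rw [fderiv_fun_const_smul (differentiableAt_axial dH dG)] at hf
  have hd : diracLap k g x = (∏ j ∈ Finset.range k, (2 * m - 2 - 4 * j : ℝ)) •
      dirac (axial (dSnd^[k] H) (dSnd^[k] G)) x := by
    simp only [diracLap, dirac, hf, smul_apply, mul_smul_comm,
      ← Finset.smul_sum, ← smul_add]
    rw [smul_comm]
  rw [hd, dirac_axial dH dG, ← Function.iterate_succ_apply' dSnd, ← Function.iterate_succ_apply' dSnd,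
    (h.iterate hW k _ hx).1, (h.iterate hW k _ hx).2, mul_smul_comm]
  module

/-- Since `y² = -s`, left multiplication by `α + y` is precisely the recursion defining `powPair`.
-/
theorem axial_powPair (a : RC m) (n : ℕ) (x : EuclideanSpace ℝ (Fin (m + 1))) :
    axial (powPair a n).1 (powPair a n).2 x = paravector x ^ n * a := by
  induction n with
  | zero => simp [axial, powPair]
  | succ n ih =>
    rw [pow_succ', mul_assoc, ← ih, paravector_eq]
    simp only [axial, powPair, add_mul, mul_add, ← mul_assoc (vecPart x), vecPart_mul_self,
      ← Algebra.smul_def, mul_smul_comm]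
    simp only [axisPt]
    module

end Axial

/-! ### Holomorphic stem functions, through their complex coordinates. -/

section Holo

variable {m : ℕ} {D : Set ℂ} {F₀ F₁ : ℂ → RC m}

/-- The complex-valued component of `F₀ + i F₁` along a real functional on `ℝ_m`. -/
def cplx (l : RC m →L[ℝ] ℝ) (F₀ F₁ : ℂ → RC m) (z : ℂ) : ℂ :=
  (l (F₀ z) : ℂ) + (l (F₁ z) : ℂ) * Complex.I

theorem IsHolo.sub {F₀' F₁' : ℂ → RC m} (h : IsHolo D F₀ F₁) (h' : IsHolo D F₀' F₁') :
    IsHolo D (fun z => F₀ z - F₀' z) (fun z => F₁ z - F₁' z) := by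
  refine ⟨fun z hz => (h.diff₀ z hz).fun_sub (h'.diff₀ z hz),
    fun z hz => (h.diff₁ z hz).fun_sub (h'.diff₁ z hz), fun z hz v => ?_, fun z hz v => ?_⟩ <;>
  rw [fderiv_fun_sub (h.diff₀ z hz) (h'.diff₀ z hz), fderiv_fun_sub (h.diff₁ z hz) (h'.diff₁ z hz)]
  · simp only [sub_apply, h.cr₀ z hz, h'.cr₀ z hz]
    abel
  · simp only [sub_apply, h.cr₁ z hz, h'.cr₁ z hz]

theorem IsHolo.differentiableOn_cplx (h : IsHolo D F₀ F₁) (l : RC m →L[ℝ] ℝ) :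
    ∀ z ∈ D, DifferentiableAt ℂ (cplx l F₀ F₁) z := by
  intro z hz
  have h0 : HasFDerivAt (fun w => (l (F₀ w) : ℂ)) (Complex.ofRealCLM ∘L l ∘L fderiv ℝ F₀ z) z :=
    Complex.ofRealCLM.hasFDerivAt.comp z (l.hasFDerivAt.comp z (h.diff₀ z hz).hasFDerivAt)
  have h1 : HasFDerivAt (fun w => (l (F₁ w) : ℂ)) (Complex.ofRealCLM ∘L l ∘L fderiv ℝ F₁ z) z :=
    Complex.ofRealCLM.hasFDerivAt.comp z (l.hasFDerivAt.comp z (h.diff₁ z hz).hasFDerivAt)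
  have hf : HasFDerivAt (cplx l F₀ F₁) _ z := h0.fun_add (h1.mul_const Complex.I)
  refine differentiableAt_complex_iff_differentiableAt_real.2 ⟨hf.differentiableAt, ?_⟩
  have c0 := h.cr₀ z hz 1
  have c1 := h.cr₁ z hz 1
  rw [mul_one] at c0 c1
  rw [hf.fderiv]
  apply Complex.ext <;> simp [c0, c1]

/-- Only real differentiability is assumed; smoothness comes from complex differentiability of each
coordinate in `basisRC`. -/
theorem IsHolo.contDiffOn (hD : IsOpen D) (h : IsHolo D F₀ F₁) :
    ContDiffOn ℝ ∞ F₀ D ∧ ContDiffOn ℝ ∞ F₁ D := by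
  let l : Finset (Fin m) → RC m →L[ℝ] ℝ := fun S => ((basisRC m).coord S).toContinuousLinearMap
  have hc : ∀ S, ContDiffOn ℝ ∞ (cplx (l S) F₀ F₁) D := fun S =>
    ((DifferentiableOn.contDiffOn (fun z hz =>
      (h.differentiableOn_cplx (l S) z hz).differentiableWithinAt) hD).restrict_scalars ℝ)
  have e0 : F₀ = fun z => ∑ S, (cplx (l S) F₀ F₁ z).re • basisRC m S := by
    funext z
    conv_lhs => rw [← (basisRC m).sum_repr (F₀ z)]
    simp [cplx, l]
  have e1 : F₁ = fun z => ∑ S, (cplx (l S) F₀ F₁ z).im • basisRC m S := by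
    funext z
    conv_lhs => rw [← (basisRC m).sum_repr (F₁ z)]
    simp [cplx, l]
  constructor
  · rw [e0]
    exact ContDiffOn.sum fun S _ =>
      (Complex.reCLM.contDiff.comp_contDiffOn (hc S)).smul contDiffOn_const
  · rw [e1]
    exact ContDiffOn.sum fun S _ =>
      (Complex.imCLM.contDiff.comp_contDiffOn (hc S)).smul contDiffOn_const

theorem IsHolo.eq_zero_of_preconnected (hD : IsOpen D) (h : IsHolo D F₀ F₁) {D' : Set ℂ}
    (hs : D' ⊆ D) (hc : IsPreconnected D') {z₀ : ℂ} (hz₀ : z₀ ∈ D')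
    (h0 : ∀ᶠ z in nhds z₀, F₀ z = 0 ∧ F₁ z = 0) : ∀ z ∈ D', F₀ z = 0 ∧ F₁ z = 0 := by
  intro z hz
  have key : ∀ S, cplx ((basisRC m).coord S).toContinuousLinearMap F₀ F₁ z = 0 := by
    intro S
    have ha : AnalyticOnNhd ℂ
        (cplx ((basisRC m).coord S).toContinuousLinearMap F₀ F₁) D' :=
      (DifferentiableOn.analyticOnNhd (fun z hz =>
        (h.differentiableOn_cplx _ z hz).differentiableWithinAt) hD).mono hs
    refine ha.eqOn_zero_of_preconnected_of_eventuallyEq_zero hc hz₀ ?_ hz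
    filter_upwards [h0] with w hw
    simp [cplx, hw.1, hw.2]
  have hre : ∀ S, (basisRC m).coord S (F₀ z) = 0 := fun S => by
    simpa [cplx] using congrArg Complex.re (key S)
  have him : ∀ S, (basisRC m).coord S (F₁ z) = 0 := fun S => by
    simpa [cplx] using congrArg Complex.im (key S)
  exact ⟨(basisRC m).forall_coord_eq_zero_iff.1 hre, (basisRC m).forall_coord_eq_zero_iff.1 him⟩

theorem isHolo_sum_pow (a : ℕ → RC m) (N : ℕ) :
    IsHolo D (fun z => ∑ n ∈ Finset.range N, (z ^ n).re • a n)
      (fun z => ∑ n ∈ Finset.range N, (z ^ n).im • a n) := by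
  have hd : ∀ (n : ℕ) (z : ℂ), DifferentiableAt ℂ (fun z : ℂ => z ^ n) z := fun n z =>
    differentiableAt_pow n
  have hr : ∀ (l : ℂ →L[ℝ] ℝ) (z : ℂ), HasFDerivAt
      (fun z : ℂ => ∑ n ∈ Finset.range N, l (z ^ n) • a n)
      (∑ n ∈ Finset.range N, (l ∘L (fderiv ℂ (fun z : ℂ => z ^ n) z).restrictScalars ℝ).smulRight
        (a n)) z := fun l z =>
    HasFDerivAt.fun_sum fun n _ =>
      (l.hasFDerivAt.comp z ((hd n z).hasFDerivAt.restrictScalars ℝ)).smul_const (a n)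
  have mulI : ∀ (n : ℕ) (z v : ℂ), fderiv ℂ (fun z : ℂ => z ^ n) z (Complex.I * v) =
      Complex.I * fderiv ℂ (fun z : ℂ => z ^ n) z v := fun n z v => by
    rw [← smul_eq_mul, map_smul, smul_eq_mul]
  refine ⟨fun z _ => (hr Complex.reCLM z).differentiableAt,
    fun z _ => (hr Complex.imCLM z).differentiableAt, fun z _ v => ?_, fun z _ v => ?_⟩
  all_goals
    have e0 := (hr Complex.reCLM z).fderiv
    have e1 := (hr Complex.imCLM z).fderiv
    simp only [Complex.reCLM_apply, Complex.imCLM_apply] at e0 e1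
    rw [e0, e1]
    simp only [sum_apply, ContinuousLinearMap.smulRight_apply, ContinuousLinearMap.comp_apply,
      ContinuousLinearMap.coe_restrictScalars', mulI, Complex.reCLM_apply, Complex.imCLM_apply,
      Complex.I_mul_re, Complex.I_mul_im, neg_smul, Finset.sum_neg_distrib]

/-! ### Passage from `z` to `(α, s)` in the upper half plane. -/

/-- The point `α + i√s` of the upper half plane. -/
def halfPt (p : ℝ × ℝ) : ℂ := p.1 + √p.2 * Complex.I

theorem halfPt_re (p : ℝ × ℝ) : (halfPt p).re = p.1 := by simp [halfPt]

theorem halfPt_im (p : ℝ × ℝ) : (halfPt p).im = √p.2 := by simp [halfPt]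

theorem continuous_halfPt : Continuous halfPt := by
  unfold halfPt
  fun_prop

theorem halfPt_re_im {z : ℂ} (hz : 0 ≤ z.im) : halfPt (z.re, z.im ^ 2) = z := by
  apply Complex.ext
  · rw [halfPt_re]
  · rw [halfPt_im, Real.sqrt_sq hz]

/-- The set of all `(α, s)` with `s > 0` and `α + i√s ∈ D`. -/
def halfDomain (D : Set ℂ) : Set (ℝ × ℝ) := {p | 0 < p.2 ∧ halfPt p ∈ D}

theorem isOpen_halfDomain (hD : IsOpen D) : IsOpen (halfDomain D) :=
  (isOpen_lt continuous_const continuous_snd).inter (hD.preimage continuous_halfPt)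

/-- Chain rule with `∂_s √s = 1/(2√s)`; the condition `s > 0` in `halfDomain` makes the square root
smooth and invertible. -/
theorem IsHolo.isCRPair (hD : IsOpen D) (h : IsHolo D F₀ F₁) :
    IsCRPair (halfDomain D) (fun p => F₀ (halfPt p)) (fun p => (√p.2)⁻¹ • F₁ (halfPt p)) := by
  obtain ⟨s0, s1⟩ := h.contDiffOn hD
  have hsq : ContDiffOn ℝ ∞ (fun p : ℝ × ℝ => √p.2) (halfDomain D) := fun p hp =>
    (contDiffAt_snd.sqrt hp.1.ne').contDiffWithinAt
  have hq : ContDiffOn ℝ ∞ halfPt (halfDomain D) :=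
    (Complex.ofRealCLM.contDiff.comp_contDiffOn contDiffOn_fst).add
      ((Complex.ofRealCLM.contDiff.comp_contDiffOn hsq).mul contDiffOn_const)
  have hm : Set.MapsTo halfPt (halfDomain D) D := fun p hp => hp.2
  have key : ∀ p ∈ halfDomain D, ∀ v : ℝ × ℝ,
      HasFDerivAt (fun p : ℝ × ℝ => √p.2) ((1 / (2 * √p.2)) • ContinuousLinearMap.snd ℝ ℝ ℝ) p ∧
      fderiv ℝ halfPt p v = v.1 + (v.2 / (2 * √p.2) : ℝ) * Complex.I := by
    intro p hp v
    have hs : HasFDerivAt (fun p : ℝ × ℝ => √p.2)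
      ((1 / (2 * √p.2)) • ContinuousLinearMap.snd ℝ ℝ ℝ) p := hasFDerivAt_snd.sqrt hp.1.ne'
    refine ⟨hs, ?_⟩
    have h1 : HasFDerivAt (fun p : ℝ × ℝ => (p.1 : ℂ))
        (Complex.ofRealCLM ∘L ContinuousLinearMap.fst ℝ ℝ ℝ) p :=
      Complex.ofRealCLM.hasFDerivAt.comp p hasFDerivAt_fst
    have h2 : HasFDerivAt (fun p : ℝ × ℝ => (√p.2 : ℂ))
        (Complex.ofRealCLM ∘L ((1 / (2 * √p.2)) • ContinuousLinearMap.snd ℝ ℝ ℝ)) p :=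
      Complex.ofRealCLM.hasFDerivAt.comp p hs
    have h3 : HasFDerivAt halfPt _ p := h1.fun_add (h2.mul_const Complex.I)
    rw [h3.fderiv]
    simp
    ring
  have comp : ∀ {F : ℂ → RC m}, (∀ z ∈ D, DifferentiableAt ℝ F z) → ∀ p ∈ halfDomain D,
      DifferentiableAt ℝ (fun p => F (halfPt p)) p ∧
      dFst (fun p => F (halfPt p)) p = fderiv ℝ F (halfPt p) 1 ∧
      dSnd (fun p => F (halfPt p)) p = (1 / (2 * √p.2)) • fderiv ℝ F (halfPt p) Complex.I := by
    intro F hF p hp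
    have dq : DifferentiableAt ℝ halfPt p :=
      differentiableAt_of_contDiffOn (isOpen_halfDomain hD) hq hp
    have hc : HasFDerivAt (fun p => F (halfPt p)) (fderiv ℝ F (halfPt p) ∘L fderiv ℝ halfPt p) p :=
      (hF _ hp.2).hasFDerivAt.comp p dq.hasFDerivAt
    refine ⟨hc.differentiableAt, ?_, ?_⟩
    · simp only [dFst, hc.fderiv, ContinuousLinearMap.comp_apply, (key p hp _).2]
      simp
    · simp only [dSnd, hc.fderiv, ContinuousLinearMap.comp_apply, (key p hp _).2]
      rw [← map_smul]
      simp
  have cr0 : ∀ z ∈ D, fderiv ℝ F₀ z Complex.I = -fderiv ℝ F₁ z 1 := fun z hz => by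
    simpa using h.cr₀ z hz 1
  have cr1 : ∀ z ∈ D, fderiv ℝ F₁ z Complex.I = fderiv ℝ F₀ z 1 := fun z hz => by
    simpa using h.cr₁ z hz 1
  -- Product rule; the last term is the derivative `-1/(2s√s)` of `1/√s`.
  have dG : ∀ p ∈ halfDomain D, ∀ v : ℝ × ℝ,
      fderiv ℝ (fun p : ℝ × ℝ => (√p.2)⁻¹ • F₁ (halfPt p)) p v =
        (√p.2)⁻¹ • fderiv ℝ (fun p => F₁ (halfPt p)) p v -
          (v.2 / (2 * p.2 * √p.2)) • F₁ (halfPt p) := by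
    intro p hp v
    have hpos : 0 < √p.2 := Real.sqrt_pos.2 hp.1
    have hi := (hasDerivAt_inv hpos.ne').comp_hasFDerivAt p (key p hp 0).1
    have := (hi.fun_smul (comp h.diff₁ p hp).1.hasFDerivAt).fderiv
    simp only [Function.comp_apply] at this
    rw [this]
    simp only [add_apply, smul_apply, ContinuousLinearMap.smulRight_apply,
      ContinuousLinearMap.coe_snd', Real.sq_sqrt hp.1.le, smul_eq_mul, sub_eq_add_neg, ← neg_smul]
    congr 2
    field_simp
  refine ⟨s0.comp hq hm, (hsq.inv fun p hp => (Real.sqrt_pos.2 hp.1).ne').smul (s1.comp hq hm),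
    fun p hp => ?_, fun p hp => ?_⟩
  all_goals
    have hpos : 0 < √p.2 := Real.sqrt_pos.2 hp.1
    obtain ⟨-, a0, b0⟩ := comp h.diff₀ p hp
    obtain ⟨-, a1, b1⟩ := comp h.diff₁ p hp
    have hp2 := hp.1
    have hsq2 := Real.sq_sqrt hp.1.le
  · have : dSnd (fun p : ℝ × ℝ => (√p.2)⁻¹ • F₁ (halfPt p)) p = _ := dG p hp (0, 1)
    rw [this, a0, ← dSnd, b1, cr1 _ hp.2]
    match_scalars
    · field_simp
      linear_combination hsq2
    · field_simp
      ring
  · have : dFst (fun p : ℝ × ℝ => (√p.2)⁻¹ • F₁ (halfPt p)) p = _ := dG p hp (1, 0)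
    rw [this, b0, ← dFst, a1, cr0 _ hp.2]
    match_scalars
    · field_simp
    · simp

end Holo

/-! ### Slice functions on the paravector domain, and the two inclusions. -/

section Slice

variable {m : ℕ} {D : Set ℂ} {F₀ F₁ : ℂ → RC m}

theorem mul_self_of_mem_imUnits {J : RC m} (hJ : J ∈ imUnits m) : J * J = -1 := by
  have h : star J = -J := eq_neg_of_add_eq_zero_right hJ.1
  have h2 := hJ.2
  rw [h, mul_neg] at h2
  rw [← h2, neg_neg]

theorem e_mem_imUnits (j : Fin m) : (e j : RC m) ∈ imUnits m := by
  have h : star (e j : RC m) = -e j := CliffordAlgebra.star_ι _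
  refine ⟨by rw [h, add_neg_cancel], ?_⟩
  rw [h, mul_neg, e_mul_self, neg_neg]

theorem unit_vecPart_mem_imUnits {x : EuclideanSpace ℝ (Fin (m + 1))} (hx : 0 < (axisPt x).2) :
    (√(axisPt x).2)⁻¹ • (vecPart x : RC m) ∈ imUnits m := by
  have hs : star ((√(axisPt x).2)⁻¹ • (vecPart x : RC m)) =
      -((√(axisPt x).2)⁻¹ • (vecPart x : RC m)) := by
    rw [CliffordAlgebra.star_smul, star_vecPart, smul_neg]
  refine ⟨by rw [hs, add_neg_cancel], ?_⟩
  rw [hs, mul_neg, smul_mul_smul_comm, vecPart_mul_self, map_neg, smul_neg, neg_neg,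
    Algebra.smul_def, ← map_mul, ← mul_inv, Real.mul_self_sqrt hx.le, inv_mul_cancel₀ hx.ne',
    map_one]

/-- Because `J² = -1`, sending `i` to `J` is a real algebra homomorphism `ℂ → ℝ_m`. -/
theorem slice_pow {J : RC m} (hJ : J ∈ imUnits m) (z : ℂ) (n : ℕ) :
    (algebraMap ℝ (RC m) z.re + z.im • J) ^ n =
      algebraMap ℝ (RC m) (z ^ n).re + (z ^ n).im • J := by
  have h := map_pow (Complex.liftAux J (mul_self_of_mem_imUnits hJ)) z n
  simpa only [Complex.liftAux_apply] using h.symm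

theorem axisPt_snd_nonneg (x : EuclideanSpace ℝ (Fin (m + 1))) : 0 ≤ (axisPt x).2 := by
  simp only [axisPt]
  positivity

theorem vecPart_eq_zero {x : EuclideanSpace ℝ (Fin (m + 1))} (hx : (axisPt x).2 = 0) :
    vecPart x = (0 : RC m) := by
  simp only [axisPt] at hx
  have h := (Finset.sum_eq_zero_iff_of_nonneg fun (j : Fin m) _ => sq_nonneg (x j.succ)).1 hx
  rw [vecPart_apply]
  exact Finset.sum_eq_zero fun j hj => by rw [pow_eq_zero_iff two_ne_zero |>.1 (h j hj), zero_smul]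

/-- The unit `J` in `circ` need not be a vector, but if `α + Jβ` is a paravector, then conjugation
separates scalar and vector parts, so `y = Jβ` and `s = β²`. The sign of `β` is lost, which the
symmetry of `D` repairs. -/
theorem mem_paraDomain_iff (hm : 0 < m) (hconj : ∀ z ∈ D, conj z ∈ D)
    (x : EuclideanSpace ℝ (Fin (m + 1))) : x ∈ paraDomain m D ↔ halfPt (axisPt x) ∈ D := by
  constructor
  · rintro ⟨z, hz, J, hJ, hx⟩
    have hsJ : star J = -J := eq_neg_of_add_eq_zero_right hJ.1
    rw [paravector_eq] at hx
    have hs := congrArg star hx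
    rw [star_add, star_add, star_vecPart, CliffordAlgebra.star_algebraMap,
      CliffordAlgebra.star_algebraMap, CliffordAlgebra.star_smul, hsJ] at hs
    have hinj : Function.Injective (algebraMap ℝ (RC m)) := FaithfulSMul.algebraMap_injective _ _
    have hre : x 0 = z.re := by
      have h2 : (2 : ℝ) • algebraMap ℝ (RC m) (x 0) = (2 : ℝ) • algebraMap ℝ (RC m) z.re := by
        rw [two_smul, two_smul]
        calc _ = algebraMap ℝ (RC m) (x 0) + vecPart x +
              (algebraMap ℝ (RC m) (x 0) + -vecPart x) := by abel
          _ = _ := by rw [hx, hs, smul_neg]; abel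
      exact hinj (smul_right_injective _ two_ne_zero h2)
    have hv : vecPart x = z.im • J := by
      rw [hre] at hx
      exact add_left_cancel hx
    have hsq : (axisPt x).2 = z.im ^ 2 := by
      have h := vecPart_mul_self x
      rw [hv, smul_mul_smul_comm, mul_self_of_mem_imUnits hJ, smul_neg, ← Algebra.algebraMap_eq_smul_one,
        ← map_neg] at h
      linarith [hinj h, pow_two z.im]
    have him : (halfPt (axisPt x)).im = |z.im| := by rw [halfPt_im, hsq, Real.sqrt_sq_eq_abs]
    have hre' : (halfPt (axisPt x)).re = z.re := by rw [halfPt_re, ← hre]; rfl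
    rcases abs_cases z.im with h | h
    · rwa [Complex.ext hre' (him.trans h.1)]
    · have : halfPt (axisPt x) = conj z :=
        Complex.ext (by simpa using hre') (by simpa using him.trans h.1)
      rw [this]
      exact hconj z hz
  · intro hz
    rcases (axisPt_snd_nonneg x).eq_or_lt with h | h
    -- At a real point the unit is multiplied by zero, so any unit will do.
    · refine ⟨_, hz, _, e_mem_imUnits ⟨0, hm⟩, ?_⟩
      rw [paravector_eq, vecPart_eq_zero h.symm, halfPt_re, halfPt_im, ← h]
      simp [axisPt]
    · refine ⟨_, hz, _, unit_vecPart_mem_imUnits h, ?_⟩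
      rw [paravector_eq, halfPt_re, halfPt_im, smul_inv_smul₀ (Real.sqrt_pos.2 h).ne']
      rfl

theorem restr_eqOn_axial {f : circ m D → RC m} (hf : IsInduced F₀ F₁ f) :
    Set.EqOn (restr f) (axial (fun p => F₀ (halfPt p)) (fun p => (√p.2)⁻¹ • F₁ (halfPt p)))
      (axisPt ⁻¹' halfDomain D) := by
  intro x hx
  have hJ := unit_vecPart_mem_imUnits (m := m) hx.1
  have hp : paravector x = algebraMap ℝ (RC m) (halfPt (axisPt x)).re +
      (halfPt (axisPt x)).im • ((√(axisPt x).2)⁻¹ • (vecPart x : RC m)) := by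
    rw [paravector_eq, halfPt_re, halfPt_im, smul_inv_smul₀ (Real.sqrt_pos.2 hx.1).ne']
    rfl
  have hmem : paravector x ∈ circ m D := hp ▸ mem_circ hx.2 hJ
  have h := hf _ hx.2 _ hJ
  rw [restr, dif_pos hmem]
  simp only [hp, h, axial, mul_smul_comm, smul_mul_assoc]

theorem mem_slicePoly_iff {f : circ m D → RC m} (d : ℕ) : f ∈ slicePoly m D d ↔
    ∃ a : ℕ → RC m, ∀ x : circ m D, f x = ∑ n ∈ Finset.range (d + 1), (x : RC m) ^ n * a n := by
  constructor
  · rintro ⟨P, hP, h⟩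
    refine ⟨P.coeff, fun x => ?_⟩
    rw [h x, evalRight, Polynomial.sum_over_range' _ (fun n => by simp) (d + 1) (by omega)]
  · rintro ⟨a, h⟩
    have hdeg : (∑ n ∈ Finset.range (d + 1), Polynomial.monomial n (a n)).natDegree ≤ d :=
      Polynomial.natDegree_sum_le_of_forall_le _ _ fun n hn =>
        (Polynomial.natDegree_monomial_le _).trans (by rw [Finset.mem_range] at hn; omega)
    refine ⟨∑ n ∈ Finset.range (d + 1), Polynomial.monomial n (a n), hdeg, fun x => ?_⟩
    rw [h x, evalRight, Polynomial.sum_over_range' _ (fun n => by simp) (d + 1) (by omega)]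
    refine Finset.sum_congr rfl fun n hn => ?_
    congr 1
    rw [Polynomial.finsetSum_coeff]
    simp only [Polynomial.coeff_monomial, Finset.sum_ite_eq', if_pos hn]

theorem isInduced_sum_pow (a : ℕ → RC m) (N : ℕ) {f : circ m D → RC m}
    (hf : ∀ x : circ m D, f x = ∑ n ∈ Finset.range N, (x : RC m) ^ n * a n) :
    IsInduced (fun z => ∑ n ∈ Finset.range N, (z ^ n).re • a n)
      (fun z => ∑ n ∈ Finset.range N, (z ^ n).im • a n) f := by
  intro z hz J hJ
  rw [hf]
  simp only [slice_pow hJ, Finset.mul_sum, ← Finset.sum_add_distrib, add_mul, ← Algebra.smul_def,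
    smul_mul_assoc, mul_smul_comm]

theorem slicePoly_subset_SR (d : ℕ) : slicePoly m D d ⊆ SR m D := by
  intro f hf
  obtain ⟨a, ha⟩ := (mem_slicePoly_iff d).1 hf
  refine ⟨_, _, ⟨fun z _ => ?_, fun z _ => ?_⟩, isHolo_sum_pow a (d + 1),
    isInduced_sum_pow a (d + 1) ha⟩
  · simp only [← map_pow, Complex.conj_re]
  · simp only [← map_pow, Complex.conj_im, neg_smul, Finset.sum_neg_distrib]

/-- Monomial pairs are polynomial on the whole plane, so no division by `√s` occurs and real points
of `Ω` are covered too. -/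
theorem isHolCliffordian_of_mem_slicePoly (hm : 0 < m) (hD : IsOpen D)
    (hconj : ∀ z ∈ D, conj z ∈ D) (k : ℕ) {f : circ m D → RC m}
    (hf : f ∈ slicePoly m D (2 * k)) : IsHolCliffordian k (paraDomain m D) (restr f) := by
  obtain ⟨a, ha⟩ := (mem_slicePoly_iff _).1 hf
  obtain ⟨hcr, h0⟩ := isCRPair_sum_powPair a k (2 * k + 1) le_rfl
  set H : ℝ × ℝ → RC m := fun p => ∑ n ∈ Finset.range (2 * k + 1), (powPair (a n) n).1 p with hH
  set G : ℝ × ℝ → RC m := fun p => ∑ n ∈ Finset.range (2 * k + 1), (powPair (a n) n).2 p with hG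
  have hW : IsOpen (halfPt ⁻¹' D) := hD.preimage continuous_halfPt
  have hpre : paraDomain m D = axisPt ⁻¹' (halfPt ⁻¹' D) :=
    Set.ext fun x => mem_paraDomain_iff hm hconj x
  have heq : Set.EqOn (restr f) (axial H G) (axisPt ⁻¹' (halfPt ⁻¹' D)) := by
    intro x hx
    have hmem : paravector x ∈ circ m D := (mem_paraDomain_iff hm hconj x).2 hx
    rw [restr, dif_pos hmem, ha]
    simp only [← axial_powPair, axial, hH, hG, Finset.mul_sum, Finset.sum_add_distrib]
  have hcr' := hcr.mono (Set.subset_univ (halfPt ⁻¹' D))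
  rw [hpre]
  refine ⟨((contDiffOn_axial hcr'.smooth₀ hcr'.smooth₁).congr heq).of_le
    (WithTop.coe_le_coe.2 le_top), fun x hx => ?_⟩
  rw [diracLap_axial hW hcr' heq k hx, h0, smul_zero]

/-- Supplies the set on which the identity theorem runs: `D` itself, or whichever of `D⁺` and its
conjugate has a point in the upper half plane. -/
theorem exists_isPreconnected_upper (hD : IsOpen D) (hconj : ∀ z ∈ D, conj z ∈ D)
    (hdom : IsSliceDomain D ∨ IsProductDomain D) :
    ∃ D' ⊆ D, IsPreconnected D' ∧ (∀ z ∈ D, z ∈ D' ∨ conj z ∈ D') ∧ ∃ z ∈ D', 0 < z.im := by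
  rcases hdom with ⟨hc, r, hr⟩ | ⟨hreal, E, hE, rfl⟩
  · refine ⟨D, subset_rfl, hc.isPreconnected, fun z hz => Or.inl hz, ?_⟩
    have ht : Filter.Tendsto (fun t : ℝ => (r : ℂ) + t * Complex.I) (nhdsWithin 0 (Set.Ioi 0))
        (nhds r) := by
      have : Continuous fun t : ℝ => (r : ℂ) + t * Complex.I := by fun_prop
      simpa using (this.tendsto 0).mono_left nhdsWithin_le_nhds
    obtain ⟨t, h1, h2⟩ := ((ht.eventually (hD.mem_nhds hr)).and self_mem_nhdsWithin).exists
    exact ⟨_, h1, by simpa using h2⟩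
  · obtain ⟨z, hz⟩ := hE.nonempty
    have him : z.im ≠ 0 := fun h => hreal z.re (by
      rw [show (z.re : ℂ) = z from Complex.ext rfl h.symm]
      exact Or.inl hz)
    rcases him.lt_or_gt with h | h
    · refine ⟨(fun z : ℂ => conj z) '' E, Set.subset_union_right,
        hE.isPreconnected.image _ Complex.continuous_conj.continuousOn, ?_,
        conj z, ⟨z, hz, rfl⟩, by simpa using h⟩
      rintro w (hw | hw)
      · exact Or.inr ⟨w, hw, rfl⟩
      · exact Or.inl hw
    · refine ⟨E, Set.subset_union_left, hE.isPreconnected, ?_, z, hz, h⟩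
      rintro w (hw | ⟨v, hv, rfl⟩)
      · exact Or.inl hw
      · exact Or.inr (by simpa using hv)

theorem mem_slicePoly_of_diracLap_eq_zero (hm : 0 < m) {k : ℕ} (hk : 2 * k + 1 < m)
    (hD : IsOpen D) (hconj : ∀ z ∈ D, conj z ∈ D) (hdom : IsSliceDomain D ∨ IsProductDomain D)
    {f : circ m D → RC m} (hf : f ∈ SR m D)
    (h0 : ∀ x ∈ paraDomain m D, diracLap k (restr f) x = 0) : f ∈ slicePoly m D (2 * k) := by
  obtain ⟨F₀, F₁, hst, hF, hind⟩ := hf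
  have hW := isOpen_halfDomain hD
  have hcr := hF.isCRPair hD
  have heq := restr_eqOn_axial hind
  -- For `j < k` the factor `2(m - 1 - 2j)` is positive, and the last factor is negative, both
  -- because `2k + 1 < m`.
  have hc : (∏ j ∈ Finset.range k, (2 * m - 2 - 4 * j : ℝ)) * ((2 * k + 1 - m) / 2 : ℝ) ≠ 0 := by
    have hk' : (2 * k + 1 : ℝ) < m := by exact_mod_cast hk
    refine mul_ne_zero (Finset.prod_ne_zero_iff.2 fun j hj => ?_) (by linarith)
    have hj' : (j : ℝ) < k := by exact_mod_cast Finset.mem_range.1 hj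
    linarith
  have hzero : ∀ p ∈ halfDomain D, dSnd^[k] (fun p => (√p.2)⁻¹ • F₁ (halfPt p)) p = 0 := by
    intro p hp
    -- The paravector `α + √s e₁` lies over `(α, s)`, so the equation on `Ω` gives `∂_s^k G = 0` at
    -- every point of `halfDomain D`.
    let x : EuclideanSpace ℝ (Fin (m + 1)) :=
      p.1 • EuclideanSpace.single 0 1 + √p.2 • EuclideanSpace.single (Fin.succ ⟨0, hm⟩) 1
    have hx : axisPt x = p := by
      refine Prod.ext (by simp [axisPt, x]) ?_
      simp only [axisPt, x]
      rw [Finset.sum_eq_single ⟨0, hm⟩]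
      · simp [Real.sq_sqrt hp.1.le]
      · intro b _ hb
        have : b.succ ≠ Fin.succ ⟨0, hm⟩ := fun h => hb (Fin.succ_injective _ h)
        simp [-Fin.succ_mk, this]
      · simp
    have h := h0 x ((mem_paraDomain_iff hm hconj x).2 (by rw [hx]; exact hp.2))
    rw [diracLap_axial hW hcr heq k (by rw [hx]; exact hp), hx] at h
    exact (smul_eq_zero.1 h).resolve_left hc
  obtain ⟨D', hsub, hpc, hcov, z₀, hz₀, him⟩ := exists_isPreconnected_upper hD hconj hdom
  have hp₀ : ((z₀.re, z₀.im ^ 2) : ℝ × ℝ) ∈ halfDomain D :=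
    ⟨by positivity, by rw [halfPt_re_im him.le]; exact hsub hz₀⟩
  -- `halfDomain D` may be disconnected, so the system is integrated only on a ball, which is
  -- convex.
  obtain ⟨r, hr, hball⟩ := Metric.isOpen_iff.1 hW _ hp₀
  obtain ⟨a, ha⟩ := IsCRPair.exists_eq_sum_powPair Metric.isOpen_ball
    (convex_ball ((z₀.re, z₀.im ^ 2) : ℝ × ℝ) r).isPreconnected k (hcr.mono hball)
    (fun p hp => hzero p (hball hp))
  have hloc : ∀ᶠ z in nhds z₀, F₀ z - ∑ n ∈ Finset.range (2 * k + 1), (z ^ n).re • a n = 0 ∧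
      F₁ z - ∑ n ∈ Finset.range (2 * k + 1), (z ^ n).im • a n = 0 := by
    have hcont : Continuous fun z : ℂ => ((z.re, z.im ^ 2) : ℝ × ℝ) := by fun_prop
    filter_upwards [hcont.continuousAt.preimage_mem_nhds (Metric.ball_mem_nhds _ hr),
      (isOpen_lt continuous_const Complex.continuous_im).mem_nhds him] with z hz hzim
    have hzim' : 0 < z.im := hzim
    obtain ⟨h1, h2⟩ := ha _ hz
    simp only [halfPt_re_im hzim'.le, Real.sqrt_sq hzim'.le] at h1 h2
    rw [inv_smul_eq_iff₀ hzim'.ne'] at h2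
    rw [h1, h2]
    simp only [Finset.smul_sum, (powPair_re_im _ _ z).1, (powPair_re_im _ _ z).2, sub_self,
      and_self]
  -- Identity theorem: `F` minus the polynomial vanishes near `z₀`, hence on all of `D'`.
  have hglob := (hF.sub (isHolo_sum_pow a (2 * k + 1))).eq_zero_of_preconnected hD hsub hpc hz₀ hloc
  have hall : ∀ z ∈ D, F₀ z = ∑ n ∈ Finset.range (2 * k + 1), (z ^ n).re • a n ∧
      F₁ z = ∑ n ∈ Finset.range (2 * k + 1), (z ^ n).im • a n := by
    intro z hz
    rcases hcov z hz with h | h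
    · exact (hglob z h).imp sub_eq_zero.1 sub_eq_zero.1
    -- On the conjugate part, both `F` and the polynomial have the stem symmetry, so equality at
    -- `z̄` gives equality at `z`.
    · have h' := (hglob _ h).imp sub_eq_zero.1 sub_eq_zero.1
      simp only [hst.even z hz, hst.odd z hz, ← map_pow, Complex.conj_re, Complex.conj_im,
        neg_smul, Finset.sum_neg_distrib, neg_inj] at h'
      exact h'
  refine (mem_slicePoly_iff _).2 ⟨a, ?_⟩
  rintro ⟨_, z, hz, J, hJ, rfl⟩
  rw [hind z hz J hJ, (hall z hz).1, (hall z hz).2]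
  exact (isInduced_sum_pow (D := D) a (2 * k + 1) (fun _ => rfl) z hz J hJ).symm

end Slice

end SliceClifford

end

theorem theorem3p2 (m k : ℕ) (hm : Odd m) (hk : (k : ℝ) < ((m : ℝ) - 1) / 2)
    (D : Set ℂ) (hD : IsOpen D) (hconj : ∀ z ∈ D, conj z ∈ D)
    (hdom : SliceClifford.IsSliceDomain D ∨ SliceClifford.IsProductDomain D) :
    (∀ f ∈ SliceClifford.SR m D,
      SliceClifford.IsHolCliffordian k (SliceClifford.paraDomain m D) (SliceClifford.restr f) ↔
        f ∈ SliceClifford.slicePoly m D (2 * k)) ∧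
    SliceClifford.kerF m D k = SliceClifford.slicePoly m D (2 * k) := by
  have hk' : 2 * k + 1 < m := by
    have : (2 * k + 1 : ℝ) < m := by linarith
    exact_mod_cast this
  refine ⟨fun f hf => ⟨fun h => ?_, fun h => ?_⟩, Set.ext fun f => ⟨?_, fun h => ?_⟩⟩
  · exact SliceClifford.mem_slicePoly_of_diracLap_eq_zero hm.pos hk' hD hconj hdom hf h.2
  · exact SliceClifford.isHolCliffordian_of_mem_slicePoly hm.pos hD hconj k h
  · rintro ⟨hf, h⟩
    exact SliceClifford.mem_slicePoly_of_diracLap_eq_zero hm.pos hk' hD hconj hdom hf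
      fun x hx => congrFun h ⟨x, hx⟩
  · exact ⟨SliceClifford.slicePoly_subset_SR _ h, funext fun x =>
      (SliceClifford.isHolCliffordian_of_mem_slicePoly hm.pos hD hconj k h).2 x x.2⟩
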